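/- A finite simple graph $G$ is called normal if there are a family $\mathbb{C}$ of cliques of $G$ and a family $\mathbb{S}$ of independent sets of $G$, each covering the vertex set $V(G)$, such that $C\cap S\neq\emptyset$ for all $C\in\mathbb{C}$ and $S\in\mathbb{S}$. The Normal Graph Conjecture of De Simone and Körner states that every finite graph with no induced subgraph isomorphic to $C_5$, $C_7$ or the complement $\overline{C_7}$ is normal. Theorem. There exists a finite graph $G$ of girth at least $8$ that is not normal. Moreover, no graph of girth at least $8$ has an induced subgraph isomorphic to $C_5$, $C_7$ or $\overline{C_7}$; consequently the Normal Graph Conjecture is false. (The girth of a graph is the length of a shortest cycle, and is $\infty$ if there is no cycle.) -/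

import Mathlib

namespace SimpleGraph

/-- A graph is normal if its vertex set has a covering `C` by cliques and a covering `S` by
independent sets such that every member of `C` meets every member of `S`. -/
def IsNormal {V : Type*} (G : SimpleGraph V) : Prop :=
  ∃ C S : Set (Set V),
    (∀ A ∈ C, G.IsClique A) ∧ (∀ B ∈ S, G.IsIndepSet B) ∧
    ⋃₀ C = Set.univ ∧ ⋃₀ S = Set.univ ∧
    ∀ A ∈ C, ∀ B ∈ S, (A ∩ B).Nonempty

/-- `G` has no induced subgraph isomorphic to the cycle `C₅`, the cycle `C₇` or the complement
of `C₇`. -/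
def HasNoForbiddenInduced {V : Type*} (G : SimpleGraph V) : Prop :=
  ¬ (cycleGraph 5).IsIndContained G ∧
  ¬ (cycleGraph 7).IsIndContained G ∧
  ¬ (cycleGraph 7)ᶜ.IsIndContained G

/-- The Normal Graph Conjecture of De Simone and Körner: every finite graph with no induced `C₅`,
`C₇` or complement of `C₇` is normal. -/
def NormalGraphConjecture : Prop :=
  ∀ (V : Type) [Finite V] (G : SimpleGraph V), G.HasNoForbiddenInduced → G.IsNormal

end SimpleGraph

/-! The counterexample is a sparse random graph with its short cycles destroyed. In a normal
triangle-free graph without isolated vertices, the cliques of the cover may be taken to be edges: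
each `v` has a neighbour `f v` such that every set of the independent cover contains exactly one of
the two (`IsNormal.exists_neighbor_choice`). Fix one such set `A`; every other vertex `b` is a leaf
attached to the centre `f b` in `A`. For any set `S` of the cover, `A \ S` is closed: if `f b` is
not in `S`, then `b` is, so no neighbour of `b` is. Moreover the leaves of `A \ S` lie in `S`, so
there are at most as many as the independence number. Thus every centre with a leaf lies in a closed
set with few leaves.

Peeling (`StarSystem.peel`) makes this absurd. The leaves of the current centres `A'` are nearly all
vertices, so `A'` dominates nearly everything, and in the random graph it then does so twice. A leaf
of a closed set has all its neighbours in `A'` inside that set. If most leaves of a large closed set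
had two such neighbours, its few centres would form a dense spot, which the random graph lacks. So
the large closed sets consist mostly of exceptional leaves, and discarding them costs little. Each
round shrinks the closed sets by a factor `r`, until they cannot hold a single star
(`not_starSystem`).

The random input is proved by union bounds: `whp_card_indepSet_le`, `whp_noDenseSpot` and
`exists_whp_dominatesTwice`. Few short cycles occur, so pruning loses a negligible number of
vertices (`exists_induce_le_egirth`), and `not_isNormal_induce` needs these properties only for the
whole graph. -/

namespace SimpleGraph

open Finset

/-! ### Closed star systems and peeling -/

section Deterministic

open scoped Classical

variable {V : Type*}

/-- The neighbours of `y` in the finite set `X`. -/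
noncomputable def nbrsIn (G : SimpleGraph V) (X : Finset V) (y : V) : Finset V :=
  X.filter (G.Adj y)

/-- The vertices outside `X` with at most `t` neighbours in `X`. -/
noncomputable def fewNbrs [Fintype V] (G : SimpleGraph V) (X : Finset V) (t : ℕ) : Finset V :=
  univ.filter fun y ↦ y ∉ X ∧ (G.nbrsIn X y).card ≤ t

/-- Every set of vertices that dominates all but a fraction `ε` of the vertices dominates twice all
but a fraction `ε'` of them. -/
def DominatesTwice [Fintype V] (G : SimpleGraph V) (ε ε' : ℝ) : Prop :=
  ∀ X : Finset V, ((G.fewNbrs X 0).card : ℝ) ≤ ε * Fintype.card V →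
    ((G.fewNbrs X 1).card : ℝ) ≤ ε' * Fintype.card V

/-- No set of at most `m` vertices has two neighbours per vertex in a disjoint set that is smaller
by a factor `q`. -/
def NoDenseSpot (G : SimpleGraph V) (m q : ℝ) : Prop :=
  ∀ X Y : Finset V, Disjoint X Y → Y.Nonempty → (X.card : ℝ) * q ≤ Y.card → (Y.card : ℝ) ≤ m →
    ∃ y ∈ Y, (G.nbrsIn X y).card ≤ 1

/-- The vertices of `B` that `f` maps into `X`. -/
noncomputable def leaves (B : Finset V) (f : V → V) (X : Finset V) : Finset V :=
  B.filter fun b ↦ f b ∈ X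

/-- `I ⊆ A` contains every vertex of `A` adjacent to a vertex of `B` that `f` maps into `I`. -/
def IsLeafClosed (G : SimpleGraph V) (A B : Finset V) (f : V → V) (I : Finset V) : Prop :=
  I ⊆ A ∧ ∀ b ∈ B, f b ∈ I → ∀ a ∈ A, G.Adj b a → a ∈ I

/-- A set of centres with at least `s` leaves each, whose leaves are all but a fraction `ε` of the
vertices, and such that each centre lies in a closed set with at most `β` leaves of these
centres. -/
structure StarSystem [Fintype V] (G : SimpleGraph V) (A B : Finset V) (f : V → V) (s : ℝ)
    (A' : Finset V) (ε β : ℝ) : Prop where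
  subset : A' ⊆ A
  le_card_leaves : ∀ a ∈ A', s ≤ (leaves B f {a}).card
  card_compl_leaves : (((leaves B f A')ᶜ).card : ℝ) ≤ ε * Fintype.card V
  exists_closed : ∀ a ∈ A', ∃ I, G.IsLeafClosed A B f I ∧ a ∈ I ∧
    ((leaves B f (I ∩ A')).card : ℝ) ≤ β

variable {G : SimpleGraph V} {A B : Finset V} {f : V → V}

lemma mem_fewNbrs [Fintype V] {X : Finset V} {t : ℕ} {y : V} :
    y ∈ G.fewNbrs X t ↔ y ∉ X ∧ (G.nbrsIn X y).card ≤ t := by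
  simp [fewNbrs]

lemma mem_leaves {X : Finset V} {b : V} : b ∈ leaves B f X ↔ b ∈ B ∧ f b ∈ X := by
  simp [leaves]

lemma leaves_mono {X Y : Finset V} (h : X ⊆ Y) : leaves B f X ⊆ leaves B f Y := fun b hb ↦ by
  rw [mem_leaves] at hb ⊢
  exact ⟨hb.1, h hb.2⟩

lemma leaves_union (X Y : Finset V) : leaves B f (X ∪ Y) = leaves B f X ∪ leaves B f Y := by
  ext b
  simp only [mem_leaves, mem_union]
  tauto

lemma disjoint_leaves {X Y : Finset V} (h : Disjoint X Y) :
    Disjoint (leaves B f X) (leaves B f Y) := by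
  rw [Finset.disjoint_left]
  intro b hb hb'
  rw [mem_leaves] at hb hb'
  exact Finset.disjoint_left.1 h hb.2 hb'.2

lemma card_mul_le_card_leaves {s : ℝ} {X : Finset V}
    (h : ∀ a ∈ X, s ≤ (leaves B f {a}).card) : (X.card : ℝ) * s ≤ (leaves B f X).card := by
  have h1 : (leaves B f X).card = ∑ a ∈ X, (leaves B f {a}).card := by
    rw [Finset.card_eq_sum_card_fiberwise (f := f) (t := X)]
    · refine Finset.sum_congr rfl fun a ha ↦ ?_
      congr 1
      ext b
      simp only [mem_filter, mem_leaves, mem_singleton]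
      constructor
      · rintro ⟨⟨h1, _⟩, h2⟩
        exact ⟨h1, h2⟩
      · rintro ⟨h1, h2⟩
        exact ⟨⟨h1, h2 ▸ ha⟩, h2⟩
    · intro b hb
      exact (mem_leaves.1 hb).2
  rw [h1]
  push_cast
  rw [← nsmul_eq_mul]
  exact Finset.card_nsmul_le_sum _ _ _ h

lemma IsLeafClosed.union {I J : Finset V} (hI : G.IsLeafClosed A B f I)
    (hJ : G.IsLeafClosed A B f J) : G.IsLeafClosed A B f (I ∪ J) := by
  refine ⟨Finset.union_subset hI.1 hJ.1, fun b hb hfb a ha hab ↦ ?_⟩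
  rcases Finset.mem_union.1 hfb with h | h
  · exact Finset.mem_union_left _ (hI.2 b hb h a ha hab)
  · exact Finset.mem_union_right _ (hJ.2 b hb h a ha hab)

variable [Fintype V]

/-- If the new leaves `L` gained by adding a closed set are mostly outside the bad set, they form a
dense spot. -/
lemma card_leaves_lt_of_noDenseSpot {m q s r ε β : ℝ} (hAB : Disjoint A B)
    (hb : G.NoDenseSpot m q) (hβ : β ≤ m) (hβ0 : 0 < β)
    (hr : 0 < r) (hs : 2 * r * q ≤ s) {A' I J : Finset V}
    (hA' : G.StarSystem A B f s A' ε β) (hI : G.IsLeafClosed A B f I)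
    (hIβ : ((leaves B f (I ∩ A')).card : ℝ) ≤ β)
    (hL : β / r < (leaves B f ((I ∩ A') \ J)).card) :
    (leaves B f ((I ∩ A') \ J)).card <
      2 * (leaves B f ((I ∩ A') \ J) ∩ G.fewNbrs A' 1).card := by
  by_contra hcon
  push Not at hcon
  set L := leaves B f ((I ∩ A') \ J) with hLdef
  have hLsub : L ⊆ leaves B f (I ∩ A') := leaves_mono Finset.sdiff_subset
  set Y := L \ G.fewNbrs A' 1 with hY
  have hsplit : (L ∩ G.fewNbrs A' 1).card + Y.card = L.card := by
    rw [add_comm]; exact Finset.card_sdiff_add_card_inter _ _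
  have hYL : (L.card : ℝ) ≤ 2 * Y.card := by
    have : L.card ≤ 2 * Y.card := by omega
    exact_mod_cast this
  have hLpos : (0 : ℝ) < L.card := lt_of_le_of_lt (by positivity) hL
  have hYpos : Y.Nonempty := by
    rw [← Finset.card_pos]
    have : (0 : ℝ) < Y.card := by linarith
    exact_mod_cast this
  have hYsub : Y ⊆ leaves B f (I ∩ A') := Finset.sdiff_subset.trans hLsub
  have hX : ((I ∩ A').card : ℝ) * s ≤ β :=
    (card_mul_le_card_leaves fun a ha ↦ hA'.le_card_leaves a (Finset.mem_inter.1 ha).2).trans hIβ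
  have hdisj : Disjoint (I ∩ A') Y := by
    rw [Finset.disjoint_left]
    intro a ha haY
    exact Finset.disjoint_left.1 hAB (hI.1 (Finset.mem_inter.1 ha).1)
      (mem_leaves.1 (hYsub haY)).1
  -- At most `β / s` centres face more than `β / (2 * r)` leaves; `2 * r * q ≤ s` makes the ratio at
  -- least `q`.
  have key := hb (I ∩ A') Y hdisj hYpos ?_ ?_
  obtain ⟨y, hy, hy1⟩ := key
  · have hyB := mem_leaves.1 (hYsub hy)
    have hyf := (Finset.mem_sdiff.1 hy).2
    have hyA' : y ∉ A' := fun h ↦ Finset.disjoint_left.1 hAB (hA'.subset h) hyB.1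
    apply hyf
    rw [fewNbrs, Finset.mem_filter]
    refine ⟨Finset.mem_univ _, hyA', le_trans (Finset.card_le_card fun a ha ↦ ?_) hy1⟩
    rw [nbrsIn, Finset.mem_filter] at ha ⊢
    -- Closedness puts every neighbour of `y` in `A'` into `I`.
    exact ⟨Finset.mem_inter.2 ⟨hI.2 y hyB.1 (Finset.mem_inter.1 hyB.2).1 a (hA'.subset ha.1) ha.2,
      ha.1⟩, ha.2⟩
  · rw [div_lt_iff₀ hr] at hL
    have h1 : ((I ∩ A').card : ℝ) * (2 * r * q) ≤ β :=
      (mul_le_mul_of_nonneg_left hs (Nat.cast_nonneg _)).trans hX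
    have h2 : (2 * r) * (((I ∩ A').card : ℝ) * q) ≤ (2 * r) * Y.card := by nlinarith
    exact le_of_mul_le_mul_left h2 (by positivity)
  · refine le_trans ?_ hβ
    exact le_trans (by exact_mod_cast Finset.card_le_card hYsub) hIβ

/-- One round of peeling: dropping a closed set, the closed sets through the other centres become
smaller by a factor `r`. -/
lemma StarSystem.peel {m q s r ε ε' β : ℝ} (hAB : Disjoint A B)
    (hf : ∀ b ∈ B, f b ∈ A ∧ G.Adj b (f b))
    (hb : G.NoDenseSpot m q) (hdom : G.DominatesTwice ε ε') (hβ : β ≤ m) (hβ0 : 0 < β)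
    (hr : 0 < r) (hs : 2 * r * q ≤ s) {A' : Finset V}
    (hA' : G.StarSystem A B f s A' ε β) :
    ∃ A'', G.StarSystem A B f s A'' (ε + 2 * ε') (β / r) := by
  set bad := G.fewNbrs A' 1 with hbad
  -- `J` will be a largest closed set with at least half of its leaves bad. Adjoining a closed set
  -- whose new leaves are mostly bad preserves this property, so maximality limits the new leaves of
  -- every closed set through a remaining centre.
  let P : Finset V → Prop := fun J ↦ G.IsLeafClosed A B f J ∧
    (leaves B f (J ∩ A')).card ≤ 2 * (leaves B f (J ∩ A') ∩ bad).card
  obtain ⟨J, hJ, hJmax⟩ := Finset.exists_max_image (univ.filter P) Finset.card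
    ⟨∅, by simp [P, IsLeafClosed, leaves]⟩
  have hPJ : P J := (Finset.mem_filter.1 hJ).2
  have hbadcard : (bad.card : ℝ) ≤ ε' * Fintype.card V := by
    refine hdom A' (le_trans ?_ hA'.card_compl_leaves)
    · have : G.fewNbrs A' 0 ⊆ (leaves B f A')ᶜ := by
        intro y hy
        rw [fewNbrs, Finset.mem_filter] at hy
        rw [Finset.mem_compl, mem_leaves]
        rintro ⟨h1, h2⟩
        have h3 : (G.nbrsIn A' y).card = 0 := by omega
        rw [Finset.card_eq_zero] at h3
        have : f y ∈ G.nbrsIn A' y := by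
          rw [nbrsIn, Finset.mem_filter]; exact ⟨h2, (hf y h1).2⟩
        rw [h3] at this
        simp at this
      exact_mod_cast Finset.card_le_card this
  refine ⟨A' \ J, Finset.sdiff_subset.trans hA'.subset,
    fun a ha ↦ hA'.le_card_leaves a (Finset.mem_sdiff.1 ha).1, ?_, ?_⟩
  · have hsub : (leaves B f (A' \ J))ᶜ ⊆ (leaves B f A')ᶜ ∪ leaves B f (J ∩ A') := by
      intro y hy
      simp only [Finset.mem_compl, mem_leaves, Finset.mem_union, Finset.mem_sdiff,
        Finset.mem_inter] at hy ⊢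
      tauto
    have h1 : ((leaves B f (A' \ J))ᶜ).card ≤
        ((leaves B f A')ᶜ).card + 2 * bad.card := by
      refine (Finset.card_le_card hsub).trans ((Finset.card_union_le _ _).trans ?_)
      have := Finset.card_le_card (Finset.inter_subset_right (s₁ := leaves B f (J ∩ A'))
        (s₂ := bad))
      have := hPJ.2
      omega
    have h2 : (((leaves B f (A' \ J))ᶜ).card : ℝ) ≤
        ((leaves B f A')ᶜ).card + 2 * bad.card := by exact_mod_cast h1
    have := hA'.card_compl_leaves
    nlinarith
  · intro a ha
    obtain ⟨haA', haJ⟩ := Finset.mem_sdiff.1 ha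
    obtain ⟨I, hI, haI, hIβ⟩ := hA'.exists_closed a haA'
    refine ⟨I, hI, haI, ?_⟩
    by_contra hcon
    push Not at hcon
    have hset : I ∩ (A' \ J) = (I ∩ A') \ J := by
      ext x; simp only [Finset.mem_inter, Finset.mem_sdiff]; tauto
    rw [hset] at hcon
    have hlt := card_leaves_lt_of_noDenseSpot hAB hb hβ hβ0 hr hs hA' hI hIβ hcon
    rw [← hbad] at hlt
    have hun : leaves B f ((J ∪ I) ∩ A') =
        leaves B f (J ∩ A') ∪ leaves B f ((I ∩ A') \ J) := by
      rw [← leaves_union]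
      congr 1
      ext x; simp only [Finset.mem_inter, Finset.mem_sdiff, Finset.mem_union]; tauto
    have hdisj : Disjoint (leaves B f (J ∩ A')) (leaves B f ((I ∩ A') \ J)) := by
      apply disjoint_leaves
      rw [Finset.disjoint_left]
      intro x hx hx'
      exact (Finset.mem_sdiff.1 hx').2 (Finset.mem_inter.1 hx).1
    have hP : P (J ∪ I) := by
      refine ⟨hPJ.1.union hI, ?_⟩
      rw [hun, Finset.union_inter_distrib_right, Finset.card_union_of_disjoint hdisj,
        Finset.card_union_of_disjoint
          (hdisj.mono Finset.inter_subset_left Finset.inter_subset_left)]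
      have := hPJ.2
      omega
    have := hJmax (J ∪ I) (Finset.mem_filter.2 ⟨Finset.mem_univ _, hP⟩)
    have h2 : J.card < (J ∪ I).card := Finset.card_lt_card
      ⟨Finset.subset_union_left, fun h ↦ haJ (h (Finset.mem_union_right _ haI))⟩
    omega

/-- Peeling repeatedly rules out star systems altogether. -/
lemma not_starSystem {m q s r β : ℝ} {e : ℕ → ℝ} (hAB : Disjoint A B)
    (hf : ∀ b ∈ B, f b ∈ A ∧ G.Adj b (f b)) (hV : 0 < Fintype.card V)
    (hb : G.NoDenseSpot m q) (hβ0 : 0 < β) (hβs : β < s)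
    (hr : 1 ≤ r) (hs : 2 * r * q ≤ s) (he0 : e 0 < 1) {k : ℕ}
    (he : ∀ j < k, 3 * e (j + 1) ≤ e j) (hdom : ∀ j < k, G.DominatesTwice (e (j + 1)) (e j / 3))
    (hβm : β * r ^ k ≤ m) (A' : Finset V) :
    ¬ G.StarSystem A B f s A' (e k) (β * r ^ k) := by
  induction k generalizing A' with
  | zero =>
    intro h
    -- Since `e 0 < 1`, some centre survives; its star alone has at least `s > β` leaves.
    have hne : A'.Nonempty := by
      rw [Finset.nonempty_iff_ne_empty]
      rintro rfl
      have := h.card_compl_leaves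
      have h0 : leaves B f ∅ = ∅ := by simp [leaves]
      rw [h0, Finset.compl_empty, Finset.card_univ] at this
      have hV' : (0 : ℝ) < Fintype.card V := by exact_mod_cast hV
      nlinarith
    obtain ⟨a, ha⟩ := hne
    obtain ⟨I, hI, haI, hIβ⟩ := h.exists_closed a ha
    have h1 := h.le_card_leaves a ha
    have h2 : (leaves B f {a}).card ≤ (leaves B f (I ∩ A')).card :=
      Finset.card_le_card (leaves_mono (by simp [haI, ha]))
    have h3 : ((leaves B f {a}).card : ℝ) ≤ (leaves B f (I ∩ A')).card := by exact_mod_cast h2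
    simp at hIβ
    linarith
  | succ k ih =>
    intro h
    have hr0 : 0 < r := by linarith
    obtain ⟨A'', h''⟩ := h.peel hAB hf hb (hdom k (Nat.lt_succ_self k)) hβm (by positivity) hr0 hs
    have hle : e (k + 1) + 2 * (e k / 3) ≤ e k := by
      have := he k (Nat.lt_succ_self k)
      linarith
    have hβ' : β * r ^ (k + 1) / r = β * r ^ k := by
      rw [pow_succ]
      field_simp
    rw [hβ'] at h''
    refine ih (fun j hj ↦ he j (by omega)) (fun j hj ↦ hdom j (by omega)) ?_ A''
      ⟨h''.subset, h''.le_card_leaves, h''.card_compl_leaves.trans ?_, h''.exists_closed⟩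
    · refine le_trans ?_ hβm
      gcongr
      omega
    · gcongr

end Deterministic

/-! ### From normality to a star system -/

/-- In a normal triangle-free graph without isolated vertices, there is a choice of a neighbour
`f v` for each vertex `v` such that the vertex set is covered by independent sets containing exactly
one of `v` and `f v` for all `v`. -/
lemma IsNormal.exists_neighbor_choice {V : Type*} {G : SimpleGraph V} (hG : G.IsNormal)
    (htri : G.CliqueFree 3) (hiso : ∀ v, ∃ u, G.Adj v u) :
    ∃ f : V → V, (∀ v, G.Adj v (f v)) ∧
      ∀ w, ∃ S : Set V, G.IsIndepSet S ∧ w ∈ S ∧ ∀ v, v ∈ S ↔ f v ∉ S := by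
  obtain ⟨C, S, hC, hS, hCu, hSu, hCS⟩ := hG
  have key : ∀ v, ∃ u, G.Adj v u ∧ ∀ B ∈ S, (v ∈ B ↔ u ∉ B) := by
    intro v
    obtain ⟨K, hK, hvK⟩ : v ∈ ⋃₀ C := hCu ▸ Set.mem_univ v
    -- If `K` were `{v}`, every independent set of the cover would contain `v`, including one that
    -- contains a neighbour of `v`.
    have hex : ∃ u ∈ K, u ≠ v := by
      by_contra! hcon
      obtain ⟨u, hu⟩ := hiso v
      obtain ⟨B, hB, huB⟩ : u ∈ ⋃₀ S := hSu ▸ Set.mem_univ u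
      obtain ⟨x, hxK, hxB⟩ := hCS K hK B hB
      rw [hcon x hxK] at hxB
      exact hS B hB hxB huB hu.ne hu
    obtain ⟨u, huK, huv⟩ := hex
    have hvu : G.Adj v u := hC K hK hvK huK huv.symm
    refine ⟨u, hvu, fun B hB ↦ ⟨fun hv hu ↦ hS B hB hv hu hvu.ne hvu, fun hu ↦ ?_⟩⟩
    obtain ⟨x, hxK, hxB⟩ := hCS K hK B hB
    by_contra hv
    have hxv : x ≠ v := fun h ↦ hv (h ▸ hxB)
    have hxu : x ≠ u := fun h ↦ hu (h ▸ hxB)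
    classical
    exact htri {v, u, x} (is3Clique_triple_iff.2
      ⟨hvu, hC K hK hvK hxK hxv.symm, hC K hK huK hxK hxu.symm⟩)
  choose f hf hfS using key
  refine ⟨f, hf, fun w ↦ ?_⟩
  obtain ⟨B, hB, hwB⟩ : w ∈ ⋃₀ S := hSu ▸ Set.mem_univ w
  exact ⟨B, hS B hB, hwB, fun v ↦ hfS v B hB⟩

open scoped Classical in
/-- A graph with small independent sets, no dense spots, and twofold domination for a suitable
sequence of fractions has no normal induced triangle-free subgraph without isolated vertices that
contains most of the vertices. -/
theorem not_isNormal_induce {V : Type*} [Fintype V] {G : SimpleGraph V} {W : Finset V}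
    {m q s r β : ℝ} {e : ℕ → ℝ} {k : ℕ} (hW : (Fintype.card V : ℝ) ≤ W.card + 2 * m)
    (hiso : ∀ w ∈ W, ∃ u ∈ W, G.Adj w u)
    (htri : (G.induce (W : Set V)).CliqueFree 3) (hWne : W.Nonempty)
    (hind : ∀ S : Finset V, G.IsIndepSet (S : Set V) → (S.card : ℝ) ≤ m)
    (hb : G.NoDenseSpot m q) (hβ0 : 0 < β) (hβs : β < s)
    (hr : 1 ≤ r) (hs : 2 * r * q ≤ s) (he0 : e 0 < 1)
    (he : ∀ j < k, 3 * e (j + 1) ≤ e j) (hdom : ∀ j < k, G.DominatesTwice (e (j + 1)) (e j / 3))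
    (hm : m = β * r ^ k) (hsize : m * s + 3 * m ≤ e k * Fintype.card V) :
    ¬ (G.induce (W : Set V)).IsNormal := by
  intro hN
  obtain ⟨f₀, hf₀, hS₀⟩ := hN.exists_neighbor_choice htri fun v ↦ by
    obtain ⟨u, hu, hvu⟩ := hiso v v.2
    exact ⟨⟨u, hu⟩, hvu⟩
  let f : V → V := fun v ↦ if h : v ∈ W then (f₀ ⟨v, h⟩ : V) else v
  have hfv : ∀ v (h : v ∈ W), f v = f₀ ⟨v, h⟩ := fun v h ↦ dif_pos h
  have hfW : ∀ v ∈ W, f v ∈ W ∧ G.Adj v (f v) := by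
    intro v hv
    rw [hfv v hv]
    exact ⟨(f₀ ⟨v, hv⟩).2, hf₀ ⟨v, hv⟩⟩
  have hcover : ∀ w ∈ W, ∃ S ⊆ W, G.IsIndepSet (S : Set V) ∧ w ∈ S ∧
      ∀ v ∈ W, (v ∈ S ↔ f v ∉ S) := by
    intro w hw
    obtain ⟨S, hS, hwS, hSf⟩ := hS₀ ⟨w, hw⟩
    have hmem : ∀ v (h : v ∈ W), v ∈ W.filter (fun v ↦ ∃ h : v ∈ W, (⟨v, h⟩ : (W : Set V)) ∈ S) ↔
        (⟨v, h⟩ : (W : Set V)) ∈ S := by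
      intro v h
      rw [Finset.mem_filter]
      exact ⟨fun ⟨_, _, h'⟩ ↦ h', fun h' ↦ ⟨h, h, h'⟩⟩
    refine ⟨W.filter fun v ↦ ∃ h : v ∈ W, (⟨v, h⟩ : (W : Set V)) ∈ S, Finset.filter_subset _ _,
      ?_, (hmem w hw).2 hwS, fun v hv ↦ ?_⟩
    · intro x hx y hy hxy hadj
      obtain ⟨_, hxW, hxS⟩ := Finset.mem_filter.1 (Finset.mem_coe.1 hx)
      obtain ⟨_, hyW, hyS⟩ := Finset.mem_filter.1 (Finset.mem_coe.1 hy)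
      exact hS hxS hyS (fun h ↦ hxy (congrArg Subtype.val h)) hadj
    · rw [hmem v hv, hSf ⟨v, hv⟩, hfv v hv]
      exact not_congr (hmem _ (f₀ ⟨v, hv⟩).2).symm
  obtain ⟨w₀, hw₀⟩ := hWne
  obtain ⟨A, hAW, hAind, _, hAf⟩ := hcover w₀ hw₀
  have hcard : 0 < Fintype.card V := Fintype.card_pos_iff.2 ⟨w₀⟩
  have hs0 : 0 < s := hβ0.trans hβs
  have hmpos : 0 < m := by rw [hm]; positivity
  have hAB : Disjoint A (W \ A) := Finset.disjoint_sdiff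
  have hf : ∀ b ∈ W \ A, f b ∈ A ∧ G.Adj b (f b) := by
    intro b hb'
    obtain ⟨hbW, hbA⟩ := Finset.mem_sdiff.1 hb'
    exact ⟨not_not.1 (mt (hAf b hbW).2 hbA), (hfW b hbW).2⟩
  have hclosed : ∀ S ⊆ W, G.IsIndepSet (S : Set V) → (∀ v ∈ W, (v ∈ S ↔ f v ∉ S)) →
      G.IsLeafClosed A (W \ A) f (A \ S) := by
    intro S hSW hSind hSf
    refine ⟨Finset.sdiff_subset, fun b hb' hfb a ha hab ↦ Finset.mem_sdiff.2 ⟨ha, fun haS ↦ ?_⟩⟩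
    have hbS : b ∈ S := (hSf b (Finset.mem_sdiff.1 hb').1).2 (Finset.mem_sdiff.1 hfb).2
    exact hSind hbS haS hab.ne hab
  refine not_starSystem hAB hf hcard hb hβ0 hβs hr hs he0 he hdom hm.ge
    (A.filter fun a ↦ s ≤ (leaves (W \ A) f {a}).card)
    ⟨Finset.filter_subset _ _, fun a ha ↦ (Finset.mem_filter.1 ha).2, ?_, ?_⟩
  · set small := A.filter fun a ↦ ¬ s ≤ (leaves (W \ A) f {a}).card with hsmall
    -- The vertices missed lie outside `W` (at most `2 * m`), in `A` (at most `m`), or in one of at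
    -- most `m` stars with fewer than `s` leaves. This accounts for `m * s + 3 * m`.
    have hsub : (leaves (W \ A) f (A.filter fun a ↦ s ≤ (leaves (W \ A) f {a}).card))ᶜ ⊆
        (Wᶜ ∪ A) ∪ small.biUnion fun a ↦ leaves (W \ A) f {a} := by
      intro y hy
      rw [Finset.mem_compl, mem_leaves, Finset.mem_filter] at hy
      by_cases hyW : y ∈ W
      · by_cases hyA : y ∈ A
        · exact Finset.mem_union_left _ (Finset.mem_union_right _ hyA)
        · have hyB : y ∈ W \ A := Finset.mem_sdiff.2 ⟨hyW, hyA⟩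
          refine Finset.mem_union_right _ (Finset.mem_biUnion.2 ⟨f y, ?_, ?_⟩)
          · rw [hsmall, Finset.mem_filter]
            exact ⟨(hf y hyB).1, fun h ↦ hy ⟨hyB, (hf y hyB).1, h⟩⟩
          · exact mem_leaves.2 ⟨hyB, Finset.mem_singleton_self _⟩
      · exact Finset.mem_union_left _ (Finset.mem_union_left _ (Finset.mem_compl.2 hyW))
    have h1 := (Finset.card_le_card hsub).trans ((Finset.card_union_le _ _).trans
      (add_le_add (Finset.card_union_le _ _) Finset.card_biUnion_le))
    have h2 : (∑ a ∈ small, ((leaves (W \ A) f {a}).card : ℝ)) ≤ m * s := by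
      have h3 : (∑ a ∈ small, ((leaves (W \ A) f {a}).card : ℝ)) ≤ small.card • s :=
        Finset.sum_le_card_nsmul _ _ _ fun a ha ↦ (not_le.1 (Finset.mem_filter.1 ha).2).le
      rw [nsmul_eq_mul] at h3
      refine h3.trans (mul_le_mul_of_nonneg_right (le_trans ?_ (hind A hAind)) hs0.le)
      exact_mod_cast Finset.card_le_card (Finset.filter_subset _ _)
    have h4 : (((leaves (W \ A) f (A.filter fun a ↦ s ≤ (leaves (W \ A) f {a}).card))ᶜ).card : ℝ) ≤
        ((Wᶜ).card + A.card) + ∑ a ∈ small, ((leaves (W \ A) f {a}).card : ℝ) := by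
      exact_mod_cast h1
    have h5 := hind A hAind
    have h6 : (W.card : ℝ) + (Wᶜ).card = Fintype.card V := by
      exact_mod_cast Finset.card_add_card_compl W
    linarith
  · intro a ha
    obtain ⟨haA, has⟩ := Finset.mem_filter.1 ha
    have hne : (leaves (W \ A) f {a}).Nonempty := by
      rw [← Finset.card_pos]
      have : (0 : ℝ) < (leaves (W \ A) f {a}).card := hs0.trans_le has
      exact_mod_cast this
    obtain ⟨b, hb'⟩ := hne
    rw [mem_leaves, Finset.mem_singleton, Finset.mem_sdiff] at hb'
    -- A covering set through a leaf `b` of `a` omits `a`, and it contains all leaves of centres in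
    -- `A \ S`.
    obtain ⟨S, hSW, hSind, hbS, hSf⟩ := hcover b hb'.1.1
    refine ⟨A \ S, hclosed S hSW hSind hSf, Finset.mem_sdiff.2 ⟨haA, ?_⟩, ?_⟩
    · rw [← hb'.2]
      exact (hSf b hb'.1.1).1 hbS
    · rw [← hm]
      refine le_trans ?_ (hind S hSind)
      have : leaves (W \ A) f ((A \ S) ∩ A.filter fun a ↦ s ≤ (leaves (W \ A) f {a}).card) ⊆ S := by
        intro y hy
        rw [mem_leaves, Finset.mem_inter, Finset.mem_sdiff, Finset.mem_sdiff] at hy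
        exact (hSf y hy.1.1).2 hy.2.1.2
      exact_mod_cast Finset.card_le_card this

/-! ### Girth and the forbidden induced subgraphs -/

/-- A graph of girth at least `8` has no induced `C₅`, `C₇` or complement of `C₇`. -/
lemma hasNoForbiddenInduced_of_le_egirth {V : Type*} {G : SimpleGraph V} (hG : 8 ≤ G.egirth) :
    G.HasNoForbiddenInduced := by
  have hcyc : ∀ n, 2 < n → n < 8 → ¬ (cycleGraph n) ⊑ G := by
    intro n hn hn8 h
    obtain ⟨v, p, hp, hpn⟩ := (cycleGraph_isContained_iff hn).1 h
    have := hG.trans (egirth_le_length hp)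
    rw [hpn] at this
    have : 8 ≤ n := by exact_mod_cast this
    omega
  refine ⟨fun h ↦ hcyc 5 (by norm_num) (by norm_num) h.isContained,
    fun h ↦ hcyc 7 (by norm_num) (by norm_num) h.isContained, fun h ↦ ?_⟩
  -- The vertices 0, 2, 4 are pairwise non-adjacent in `C₇`, so they form a triangle in its
  -- complement.
  refine hcyc 3 (by norm_num) (by norm_num) (IsContained.trans ?_ h.isContained)
  refine ⟨⟨⟨![0, 2, 4], ?_⟩, ?_⟩⟩
  · intro a b
    revert a b
    decide
  · intro a b
    revert a b
    decide

end SimpleGraph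

namespace SimpleGraph

open Finset MeasureTheory ProbabilityTheory Filter Topology
open scoped unitInterval

/-! ### The random graph: independence, union bounds and first moments -/

section RandomGraph

variable {V : Type*}

/-- The graph whose edges are the non-loops marked by `ω`. -/
def markedGraph (ω : Sym2 V → Bool) : SimpleGraph V := fromEdgeSet {e | ω e = true}

lemma markedGraph_adj {ω : Sym2 V → Bool} {u v : V} :
    (markedGraph ω).Adj u v ↔ ω s(u, v) = true ∧ u ≠ v := by
  simp [markedGraph]

lemma mem_nbrsIn {G : SimpleGraph V} {X : Finset V} {x y : V} :
    x ∈ G.nbrsIn X y ↔ x ∈ X ∧ G.Adj y x := by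
  simp [nbrsIn]

lemma injOn_sym2_mk (y : V) (X : Finset V) : Set.InjOn (fun x ↦ s(y, x)) (X : Set V) := by
  intro x _ x' _ h
  rcases Sym2.eq_iff.1 h with ⟨_, h1⟩ | ⟨h1, h2⟩
  · exact h1
  · exact h2.trans h1

lemma card_nbrsIn_markedGraph_eq_zero [DecidableEq V] {ω : Sym2 V → Bool} {X : Finset V} {y : V} (hy : y ∉ X) :
    ((markedGraph ω).nbrsIn X y).card = 0 ↔ ∀ e ∈ X.image fun x ↦ s(y, x), ω e = false := by
  rw [Finset.card_eq_zero, Finset.eq_empty_iff_forall_notMem]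
  simp only [mem_nbrsIn, markedGraph_adj, Finset.forall_mem_image, not_and]
  refine forall₂_congr fun x hx ↦ ⟨fun h ↦ ?_, fun h ↦ by simp [h]⟩
  by_contra hω
  exact h (by simpa using hω) fun h' ↦ hy (h' ▸ hx)

open scoped Classical in
/-- The number of labelled cycles of length between `3` and `7`. -/
noncomputable def shortCycleCount [Fintype V] (G : SimpleGraph V) : ℕ :=
  ∑ m ∈ range 5, (univ.filter fun φ : Fin (m + 3) → V ↦
    Function.Injective φ ∧ ∀ i, G.Adj (φ i) (φ (i + 1))).card

variable [Fintype V] [DecidableEq V]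

/-- The product measure that makes each pair an edge with probability `p`, independently. -/
noncomputable def edgeMeasure (V : Type*) [Fintype V] [DecidableEq V] (p : I) :
    Measure (Sym2 V → Bool) :=
  Measure.pi fun _ ↦ bernoulliMeasure true false p

variable {p : I}

instance : IsProbabilityMeasure (edgeMeasure V p) := by
  unfold edgeMeasure; infer_instance

lemma edgeMeasure_real_forall_eq (T : Finset (Sym2 V)) (c : Bool) :
    (edgeMeasure V p).real {ω | ∀ e ∈ T, ω e = c} = (cond c (p : ℝ) (1 - p)) ^ T.card := by
  classical
  have h : {ω : Sym2 V → Bool | ∀ e ∈ T, ω e = c} =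
      Set.univ.pi fun e ↦ if e ∈ T then {c} else Set.univ := by
    ext ω
    simp only [Set.mem_ofPred_eq, Set.mem_univ_pi]
    refine forall_congr' fun e ↦ ?_
    split_ifs with he <;> simp [he]
  rw [h, edgeMeasure, measureReal_def, Measure.pi_pi, ENNReal.toReal_prod]
  have h2 : ∀ e : Sym2 V, (bernoulliMeasure true false p
      (if e ∈ T then {c} else Set.univ)).toReal = if e ∈ T then cond c (p : ℝ) (1 - p) else 1 := by
    intro e
    split_ifs
    · rw [bernoulliMeasure_apply _ (measurableSet_singleton _)]
      cases c <;> simp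
    · simp
  rw [Finset.prod_congr rfl fun e _ ↦ h2 e]
  simp

lemma edgeMeasure_real_inter {S T : Finset (Sym2 V)} (hST : Disjoint S T)
    {E F : Set (Sym2 V → Bool)} (hE : DependsOn (· ∈ E) (S : Set (Sym2 V)))
    (hF : DependsOn (· ∈ F) (T : Set (Sym2 V))) :
    (edgeMeasure V p).real (E ∩ F) =
      (edgeMeasure V p).real E * (edgeMeasure V p).real F := by
  have hind : iIndepFun (fun (e : Sym2 V) (ω : Sym2 V → Bool) ↦ ω e) (edgeMeasure V p) :=
    iIndepFun_pi (X := fun _ ↦ id) fun _ ↦ aemeasurable_id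
  have h := hind.indepFun_finset S T hST fun e ↦ measurable_pi_apply e
  -- An event depending only on the coordinates in `U` is the preimage of its own image under
  -- restriction to `U`.
  have hpre : ∀ (U : Finset (Sym2 V)) (D : Set (Sym2 V → Bool)),
      DependsOn (· ∈ D) (U : Set (Sym2 V)) →
      D = (fun (ω : Sym2 V → Bool) (i : U) ↦ ω i) ⁻¹'
        ((fun (ω : Sym2 V → Bool) (i : U) ↦ ω i) '' D) := by
    intro U D hD
    ext ω
    constructor
    · intro hω
      exact ⟨ω, hω, rfl⟩
    · rintro ⟨ω', hω', hEq⟩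
      have : (ω' ∈ D) = (ω ∈ D) := hD fun i hi ↦ congrFun hEq ⟨i, hi⟩
      exact this ▸ hω'
  have := h.measure_inter_preimage_eq_mul _ _ (Set.toFinite
    ((fun (ω : Sym2 V → Bool) (i : S) ↦ ω i) '' E)).measurableSet (Set.toFinite
    ((fun (ω : Sym2 V → Bool) (i : T) ↦ ω i) '' F)).measurableSet
  rw [← hpre S E hE, ← hpre T F hF] at this
  simp only [measureReal_def, this, ENNReal.toReal_mul]

lemma edgeMeasure_real_forall {ι : Type*} [DecidableEq ι] (Y : Finset ι)
    (T : ι → Finset (Sym2 V)) (E : ι → Set (Sym2 V → Bool))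
    (hT : (Y : Set ι).PairwiseDisjoint T)
    (hE : ∀ i ∈ Y, DependsOn (· ∈ E i) (T i : Set (Sym2 V))) :
    (edgeMeasure V p).real {ω | ∀ i ∈ Y, ω ∈ E i} =
      ∏ i ∈ Y, (edgeMeasure V p).real (E i) := by
  induction Y using Finset.induction_on with
  | empty => simp
  | insert a Y ha ih =>
    rw [Finset.prod_insert ha, ← ih (hT.subset (by simp)) fun i hi ↦ hE i (mem_insert_of_mem hi)]
    have hset : {ω | ∀ i ∈ insert a Y, ω ∈ E i} = E a ∩ {ω | ∀ i ∈ Y, ω ∈ E i} := by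
      ext ω; simp
    rw [hset]
    refine edgeMeasure_real_inter (S := T a) (T := Y.biUnion T) ?_ (hE a (mem_insert_self a Y)) ?_
    · rw [Finset.disjoint_biUnion_right]
      intro i hi
      exact hT (by simp) (by simp [hi]) fun h ↦ ha (h ▸ hi)
    · intro ω ω' hω
      refine propext (forall₂_congr fun i hi ↦ iff_of_eq (hE i (mem_insert_of_mem hi) fun e he ↦ ?_))
      exact hω e (by simpa using ⟨i, hi, he⟩)

/-- As `X` and `Y` are disjoint, different `y` in `Y` use disjoint sets of pairs, so their degrees
into `X` are independent. -/
lemma edgeMeasure_real_forall_card_nbrsIn (Q : ℕ → Prop) {X Y : Finset V} (hXY : Disjoint X Y) :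
    (edgeMeasure V p).real {ω | ∀ y ∈ Y, Q ((markedGraph ω).nbrsIn X y).card} =
      ∏ y ∈ Y, (edgeMeasure V p).real {ω | Q ((markedGraph ω).nbrsIn X y).card} := by
  refine edgeMeasure_real_forall Y (fun y ↦ X.image fun x ↦ s(y, x))
    (fun y ↦ {ω | Q ((markedGraph ω).nbrsIn X y).card}) ?_ fun y _ ω ω' h ↦ ?_
  · intro y hy y' hy' hne
    rw [Function.onFun, Finset.disjoint_left]
    intro e he he'
    obtain ⟨x, hx, rfl⟩ := Finset.mem_image.1 he
    obtain ⟨x', hx', h⟩ := Finset.mem_image.1 he'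
    rcases Sym2.eq_iff.1 h with ⟨h1, _⟩ | ⟨h1, _⟩
    · exact hne h1.symm
    · exact Finset.disjoint_left.1 hXY hx (h1 ▸ hy')
  · have : (markedGraph ω).nbrsIn X y = (markedGraph ω').nbrsIn X y := by
      ext x
      rw [mem_nbrsIn, mem_nbrsIn, markedGraph_adj, markedGraph_adj]
      refine and_congr_right fun hx ↦ ?_
      rw [h s(y, x) (by simpa using ⟨x, hx, Or.inl rfl⟩)]
    simp only [Set.mem_ofPred_eq, this]

/-- A union bound over a set of `k` vertices and a disjoint set of `l` vertices. -/
lemma edgeMeasure_real_exists_le (Q : ℕ → Prop) {k : ℕ} (l : ℕ) {t : ℝ} (ht : 0 ≤ t)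
    (h : ∀ (X : Finset V) (y : V), X.card = k → y ∉ X →
      (edgeMeasure V p).real {ω | Q ((markedGraph ω).nbrsIn X y).card} ≤ t) :
    (edgeMeasure V p).real {ω | ∃ X Y : Finset V, X.card = k ∧ Y.card = l ∧ Disjoint X Y ∧
      ∀ y ∈ Y, Q ((markedGraph ω).nbrsIn X y).card} ≤
    (Fintype.card V).choose k * (Fintype.card V).choose l * t ^ l := by
  classical
  let P : Finset (Finset V × Finset V) :=
    (univ : Finset V).powersetCard k ×ˢ (univ : Finset V).powersetCard l
  let E : Finset V × Finset V → Set (Sym2 V → Bool) := fun S ↦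
    {ω | Disjoint S.1 S.2 ∧ ∀ y ∈ S.2, Q ((markedGraph ω).nbrsIn S.1 y).card}
  have hsub : {ω | ∃ X Y : Finset V, X.card = k ∧ Y.card = l ∧ Disjoint X Y ∧
      ∀ y ∈ Y, Q ((markedGraph ω).nbrsIn X y).card} ⊆ ⋃ S ∈ P, E S := by
    rintro ω ⟨X, Y, hX, hY, hXY, hQ⟩
    rw [Set.mem_iUnion₂]
    exact ⟨(X, Y), by simp [P, hX, hY], hXY, hQ⟩
  have hle : ∀ S ∈ P, (edgeMeasure V p).real (E S) ≤ t ^ l := by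
    rintro ⟨X, Y⟩ hS
    simp only [P, Finset.mem_product, Finset.mem_powersetCard_univ] at hS
    by_cases hXY : Disjoint X Y
    · have hE : E (X, Y) = {ω | ∀ y ∈ Y, Q ((markedGraph ω).nbrsIn X y).card} := by
        ext ω; simp [E, hXY]
      rw [hE, edgeMeasure_real_forall_card_nbrsIn Q hXY, ← hS.2]
      refine (Finset.prod_le_prod (fun _ _ ↦ measureReal_nonneg) fun y hy ↦
        h X y hS.1 fun hyX ↦ Finset.disjoint_left.1 hXY hyX hy).trans ?_
      simp
    · have hE : E (X, Y) = ∅ := by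
        ext ω; simp [E, hXY]
      rw [hE]
      simpa using pow_nonneg ht l
  refine (measureReal_mono hsub (measure_ne_top _ _)).trans ((measureReal_biUnion_finset_le _ _).trans ?_)
  refine (Finset.sum_le_card_nsmul _ _ _ hle).trans ?_
  simp [P, Finset.card_univ]

lemma edgeMeasure_real_card_nbrsIn_eq_zero {X : Finset V} {y : V} (hy : y ∉ X) :
    (edgeMeasure V p).real {ω | ((markedGraph ω).nbrsIn X y).card = 0} =
      (1 - p : ℝ) ^ X.card := by
  simp_rw [card_nbrsIn_markedGraph_eq_zero hy]
  rw [edgeMeasure_real_forall_eq, Finset.card_image_of_injOn (injOn_sym2_mk y X)]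
  rfl

lemma edgeMeasure_real_card_nbrsIn_ne_zero {X : Finset V} {y : V} (hy : y ∉ X) :
    (edgeMeasure V p).real {ω | ((markedGraph ω).nbrsIn X y).card ≠ 0} =
      1 - (1 - p : ℝ) ^ X.card := by
  rw [← edgeMeasure_real_card_nbrsIn_eq_zero hy, ← probReal_compl_eq_one_sub
    (Set.toFinite _).measurableSet]
  rfl

/-- Union bound over the ordered pairs of distinct elements of `X`, of which there are at most
`X.card ^ 2`. -/
lemma edgeMeasure_real_two_le_card_nbrsIn (X : Finset V) (y : V) :
    (edgeMeasure V p).real {ω | 2 ≤ ((markedGraph ω).nbrsIn X y).card} ≤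
      (X.card * p : ℝ) ^ 2 := by
  classical
  have hsub : {ω : Sym2 V → Bool | 2 ≤ ((markedGraph ω).nbrsIn X y).card} ⊆
      ⋃ P ∈ X.offDiag, {ω | ∀ e ∈ ({P.1, P.2} : Finset V).image fun x ↦ s(y, x), ω e = true} := by
    intro ω hω
    obtain ⟨a, ha, b, hb, hab⟩ := Finset.one_lt_card.1 (Nat.lt_of_succ_le hω)
    rw [mem_nbrsIn, markedGraph_adj] at ha hb
    rw [Set.mem_iUnion₂]
    refine ⟨(a, b), by simp [ha.1, hb.1, hab], ?_⟩
    simp [ha.2.1, hb.2.1]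
  refine (measureReal_mono hsub (measure_ne_top _ _)).trans ((measureReal_biUnion_finset_le _ _).trans ?_)
  refine (Finset.sum_le_card_nsmul _ _ ((p : ℝ) ^ 2) fun P hP ↦ ?_).trans ?_
  · rw [edgeMeasure_real_forall_eq, Finset.card_image_of_injOn (injOn_sym2_mk y _),
      Finset.card_pair (Finset.mem_offDiag.1 hP).2.2]
    rfl
  · rw [nsmul_eq_mul, mul_pow]
    refine mul_le_mul_of_nonneg_right ?_ (by positivity)
    rw [Finset.offDiag_card, sq]
    exact_mod_cast Nat.sub_le _ _

/-- The `m + 3` edges are distinct coordinates: two of them could coincide only reversed, which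
would force `2 = 0` in `Fin (m + 3)`. -/
lemma edgeMeasure_real_cycle {m : ℕ} {φ : Fin (m + 3) → V} (hφ : Function.Injective φ) :
    (edgeMeasure V p).real {ω | ∀ i, (markedGraph ω).Adj (φ i) (φ (i + 1))} ≤
      (p : ℝ) ^ (m + 3) := by
  have hinj : Function.Injective fun i ↦ s(φ i, φ (i + 1)) := by
    intro i j h
    rcases Sym2.eq_iff.1 h with ⟨h1, _⟩ | ⟨h1, h2⟩
    · exact hφ h1
    · have h3 : i = j + 1 := hφ h1
      have h4 : i + 1 = j := hφ h2
      rw [h3, add_assoc, add_eq_left] at h4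
      have := congrArg Fin.val h4
      rw [Fin.val_add] at this
      simp only [Fin.val_one, Fin.val_zero, Nat.reduceAdd] at this
      rw [Nat.mod_eq_of_lt (by omega)] at this
      omega
  have hsub : {ω : Sym2 V → Bool | ∀ i, (markedGraph ω).Adj (φ i) (φ (i + 1))} ⊆
      {ω | ∀ e ∈ univ.image fun i ↦ s(φ i, φ (i + 1)), ω e = true} := by
    intro ω hω e he
    obtain ⟨i, _, rfl⟩ := Finset.mem_image.1 he
    exact (markedGraph_adj.1 (hω i)).1
  refine (measureReal_mono hsub).trans ?_
  rw [edgeMeasure_real_forall_eq, Finset.card_image_of_injective _ hinj]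
  simp

-- Markov's inequality, with the expectation computed term by term over the maps `φ`.
open scoped Classical in
lemma mul_edgeMeasure_real_shortCycleCount_le {c : ℝ} :
    c * (edgeMeasure V p).real {ω | c ≤ (markedGraph ω).shortCycleCount} ≤
      ∑ m ∈ range 5, ((Fintype.card V : ℝ) * p) ^ (m + 3) := by
  let F : (m : ℕ) → (Fin (m + 3) → V) → Set (Sym2 V → Bool) := fun m φ ↦
    {ω | Function.Injective φ ∧ ∀ i, (markedGraph ω).Adj (φ i) (φ (i + 1))}
  have hF : ∀ m φ, (edgeMeasure V p).real (F m φ) ≤ (p : ℝ) ^ (m + 3) := by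
    intro m φ
    by_cases hφ : Function.Injective φ
    · have : F m φ = {ω | ∀ i, (markedGraph ω).Adj (φ i) (φ (i + 1))} := by
        ext ω; simp [F, hφ]
      rw [this]
      exact edgeMeasure_real_cycle hφ
    · have : F m φ = ∅ := by
        ext ω; simp [F, hφ]
      rw [this]
      simpa using pow_nonneg p.2.1 _
  have hcount : ∀ ω : Sym2 V → Bool, ((markedGraph ω).shortCycleCount : ℝ) =
      ∑ m ∈ range 5, ∑ φ : Fin (m + 3) → V, (F m φ).indicator 1 ω := by
    intro ω
    rw [shortCycleCount]
    push_cast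
    refine Finset.sum_congr rfl fun m _ ↦ ?_
    rw [Finset.card_filter]
    push_cast
    refine Finset.sum_congr rfl fun φ _ ↦ ?_
    simp [F, Set.indicator_apply]
  have hint : ∀ g : (Sym2 V → Bool) → ℝ, Integrable g (edgeMeasure V p) :=
    fun g ↦ Integrable.of_finite
  refine (mul_meas_ge_le_integral_of_nonneg (.of_forall fun ω ↦ Nat.cast_nonneg _) (hint _)
    c).trans ?_
  simp_rw [hcount]
  rw [integral_finsetSum _ fun _ _ ↦ hint _]
  refine Finset.sum_le_sum fun m _ ↦ ?_
  rw [integral_finsetSum _ fun _ _ ↦ hint _]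
  refine (Finset.sum_le_sum fun φ _ ↦ ?_).trans (Finset.sum_le_card_nsmul univ
    (fun _ : Fin (m + 3) → V ↦ (p : ℝ) ^ (m + 3)) _ fun _ _ ↦ le_rfl) |>.trans ?_
  · rw [integral_indicator_one (Set.toFinite _).measurableSet]
    exact hF m φ
  · simp [mul_pow]

end RandomGraph

/-! ### Isomorphism invariance and removal of short cycles -/

/-- Normality is invariant under isomorphism. -/
lemma IsNormal.of_iso {V W : Type*} {G : SimpleGraph V} {H : SimpleGraph W} (e : G ≃g H)
    (hG : G.IsNormal) : H.IsNormal := by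
  obtain ⟨C, S, hC, hS, hCu, hSu, hCS⟩ := hG
  have hcov : ∀ D : Set (Set V), ⋃₀ D = Set.univ →
      ⋃₀ ((fun A ↦ e '' A) '' D) = Set.univ := by
    intro D hD
    refine Set.eq_univ_of_forall fun w ↦ ?_
    obtain ⟨A, hA, hw⟩ : e.symm w ∈ ⋃₀ D := hD ▸ Set.mem_univ _
    exact ⟨e '' A, ⟨A, hA, rfl⟩, e.symm w, hw, e.apply_symm_apply w⟩
  refine ⟨(fun A ↦ e '' A) '' C, (fun A ↦ e '' A) '' S, ?_, ?_, hcov C hCu, hcov S hSu, ?_⟩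
  · rintro _ ⟨A, hA, rfl⟩ _ ⟨x, hx, rfl⟩ _ ⟨y, hy, rfl⟩ hxy
    exact e.map_adj_iff.2 (hC A hA hx hy fun h ↦ hxy (h ▸ rfl))
  · rintro _ ⟨A, hA, rfl⟩ _ ⟨x, hx, rfl⟩ _ ⟨y, hy, rfl⟩ hxy hadj
    exact hS A hA hx hy (fun h ↦ hxy (h ▸ rfl)) (e.map_adj_iff.1 hadj)
  · rintro _ ⟨A, hA, rfl⟩ _ ⟨B, hB, rfl⟩
    obtain ⟨x, hxA, hxB⟩ := hCS A hA B hB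
    exact ⟨e x, ⟨x, hxA, rfl⟩, ⟨x, hxB, rfl⟩⟩

lemma cliqueFree_three_of_le_egirth {V : Type*} {G : SimpleGraph V} (hG : 8 ≤ G.egirth) :
    G.CliqueFree 3 := by
  intro s hs
  obtain ⟨u, w, hw, hlen⟩ := is3Clique_iff_exists_cycle_length_three.1 ⟨s, hs⟩
  have := hG.trans (egirth_le_length hw)
  rw [hlen] at this
  have : 8 ≤ 3 := by exact_mod_cast this
  omega

open scoped Classical in
/-- Deleting one vertex from each short cycle, and then the isolated vertices, leaves an induced
subgraph of girth at least `8` without isolated vertices. -/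
lemma exists_induce_le_egirth {V : Type*} [Fintype V] (G : SimpleGraph V)
    {m : ℕ} (hm : ∀ S : Finset V, G.IsIndepSet (S : Set V) → S.card ≤ m) :
    ∃ W : Finset V, Fintype.card V ≤ W.card + (G.shortCycleCount + m) ∧ (∀ w ∈ W, ∃ u ∈ W, G.Adj w u) ∧
      8 ≤ (G.induce (W : Set V)).egirth := by
  let R : Finset V := (range 5).biUnion fun l ↦
    (univ.filter fun φ : Fin (l + 3) → V ↦
      Function.Injective φ ∧ ∀ i, G.Adj (φ i) (φ (i + 1))).image fun φ ↦ φ 0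
  -- `D` collects the vertices isolated once `R` is gone. It is independent, hence small, and its
  -- removal isolates no further vertex.
  let D : Finset V := univ.filter fun v ↦ v ∉ R ∧ ∀ u ∉ R, ¬ G.Adj v u
  have hR : R.card ≤ G.shortCycleCount :=
    Finset.card_biUnion_le.trans (Finset.sum_le_sum fun l _ ↦ Finset.card_image_le)
  have hD : D.card ≤ m := by
    refine hm D fun x hx y hy _ hadj ↦ ?_
    exact (Finset.mem_filter.1 (Finset.mem_coe.1 hx)).2.2 y
      (Finset.mem_filter.1 (Finset.mem_coe.1 hy)).2.1 hadj
  refine ⟨(R ∪ D)ᶜ, ?_, ?_, ?_⟩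
  · rw [← Finset.card_compl_add_card (R ∪ D)]
    exact Nat.add_le_add_left ((Finset.card_union_le _ _).trans (add_le_add hR hD)) _
  · intro w hw
    simp only [D, Finset.mem_compl, Finset.mem_union, Finset.mem_filter, Finset.mem_univ, true_and,
      not_or, not_and, not_forall, not_not] at hw ⊢
    obtain ⟨u, hu, hwu⟩ := hw.2 hw.1
    exact ⟨u, ⟨hu, fun _ ↦ ⟨w, hw.1, hwu.symm⟩⟩, hwu⟩
  · rw [le_egirth]
    intro a w hw
    by_contra hcon
    have hlen : w.length < 8 := by
      have := not_le.1 hcon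
      exact_mod_cast this
    have h3 := hw.three_le_length
    obtain ⟨l, hl⟩ : ∃ l, w.length = l + 3 := ⟨w.length - 3, by omega⟩
    obtain ⟨c⟩ := (cycleGraph_isContained_iff (by omega)).2 ⟨a, w, hw, hl⟩
    have hadj : ∀ i : Fin (l + 3), (cycleGraph (l + 3)).Adj i (i + 1) := by
      intro i
      rw [cycleGraph_adj]
      right
      simp
    have hmem : (c 0 : V) ∈ R := by
      refine Finset.mem_biUnion.2 ⟨l, Finset.mem_range.2 (by omega), Finset.mem_image.2
        ⟨fun i ↦ (c i : V), Finset.mem_filter.2 ⟨Finset.mem_univ _, ?_, fun i ↦ ?_⟩, rfl⟩⟩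
      · exact Subtype.val_injective.comp c.injective
      · exact c.toHom.map_adj (hadj i)
    have h0 := (c 0).2
    rw [Finset.mem_coe, Finset.mem_compl] at h0
    exact h0 (Finset.mem_union_left _ hmem)

/-! ### Asymptotics: short cycles, independent sets and dense spots -/

section Asymptotics

/-- The edge probability `N⁻⁷⁰`, for which a graph on `N ^ 80` vertices has average degree about
`N ^ 10`. -/
noncomputable def edgeProb (N : ℕ) : I :=
  ⟨((N : ℝ) ^ 70)⁻¹, by positivity, by
    rcases Nat.eq_zero_or_pos N with rfl | h
    · simp
    · exact inv_le_one_of_one_le₀ (one_le_pow₀ (by exact_mod_cast h))⟩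

/-- The property `P` holds with high probability in the random graph on `N ^ 80` vertices with edge
probability `N⁻⁷⁰`. -/
def Whp (P : ∀ N : ℕ, SimpleGraph (Fin (N ^ 80)) → Prop) : Prop :=
  Tendsto (fun N : ℕ ↦ (edgeMeasure (Fin (N ^ 80)) (edgeProb N)).real
    {ω | ¬ P N (markedGraph ω)}) atTop (𝓝 0)

variable {P Q : ∀ N : ℕ, SimpleGraph (Fin (N ^ 80)) → Prop}

lemma Whp.of_le {u : ℕ → ℝ} (hu : Tendsto u atTop (𝓝 0))
    (h : ∀ᶠ N in atTop, (edgeMeasure (Fin (N ^ 80)) (edgeProb N)).real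
      {ω | ¬ P N (markedGraph ω)} ≤ u N) : Whp P :=
  squeeze_zero' (.of_forall fun _ ↦ measureReal_nonneg) h hu

lemma Whp.mono (hP : Whp P) (h : ∀ᶠ N in atTop, ∀ G, P N G → Q N G) : Whp Q := by
  refine Whp.of_le hP ?_
  filter_upwards [h] with N hN
  exact measureReal_mono (fun ω hω hP' ↦ hω (hN _ hP')) (measure_ne_top _ _)

lemma Whp.and (hP : Whp P) (hQ : Whp Q) : Whp fun N G ↦ P N G ∧ Q N G := by
  have h := Tendsto.add hP hQ
  rw [add_zero] at h
  refine Whp.of_le h (.of_forall fun N ↦ ?_)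
  refine (measureReal_mono ?_ (measure_ne_top _ _)).trans (measureReal_union_le _ _)
  intro ω hω
  by_contra hcon
  simp only [Set.mem_union, Set.mem_ofPred_eq, not_or, not_not] at hcon
  exact hω hcon

lemma Whp.forall_lt {P : ℕ → ∀ N : ℕ, SimpleGraph (Fin (N ^ 80)) → Prop} (k : ℕ)
    (hP : ∀ j < k, Whp (P j)) : Whp fun N G ↦ ∀ j < k, P j N G := by
  induction k with
  | zero =>
    refine Whp.of_le tendsto_const_nhds (.of_forall fun N ↦ ?_)
    simp
  | succ k ih =>
    refine ((ih fun j hj ↦ hP j (by omega)).and (hP k (Nat.lt_succ_self k))).mono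
      (.of_forall fun N G hG j hj ↦ ?_)
    rcases Nat.lt_succ_iff_lt_or_eq.1 hj with h | rfl
    · exact hG.1 j h
    · exact hG.2

lemma Whp.eventually_exists (hP : Whp P) : ∀ᶠ N in atTop, ∃ G, P N G := by
  have h : ∀ᶠ N in atTop, (edgeMeasure (Fin (N ^ 80)) (edgeProb N)).real
      {ω | ¬ P N (markedGraph ω)} < 1 := hP.eventually (gt_mem_nhds one_pos)
  filter_upwards [h] with N hN
  by_contra! hcon
  have : {ω | ¬ P N (markedGraph ω)} = Set.univ := Set.eq_univ_of_forall fun ω ↦ hcon _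
  rw [this] at hN
  simp at hN

/-- One term of the binomial expansion of `(x + 1) ^ n`. -/
lemma choose_mul_pow_le_exp (n u : ℕ) {x : ℝ} (hx : 0 ≤ x) :
    (n.choose u : ℝ) * x ^ u ≤ Real.exp (x * n) := by
  rcases lt_or_ge n u with h | h
  · rw [Nat.choose_eq_zero_of_lt h]
    simpa using (Real.exp_pos _).le
  · have h1 : (n.choose u : ℝ) * x ^ u ≤ (x + 1) ^ n := by
      rw [add_pow]
      have := Finset.single_le_sum (f := fun m ↦ x ^ m * 1 ^ (n - m) * (n.choose m : ℝ))
        (fun m _ ↦ by positivity) (Finset.mem_range.2 (Nat.lt_succ_of_le h))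
      refine le_trans (le_of_eq ?_) this
      simp [mul_comm]
    refine h1.trans ?_
    rw [mul_comm x, Real.exp_nat_mul]
    exact pow_le_pow_left₀ (by positivity) (Real.add_one_le_exp x) n

lemma one_sub_pow_le_exp {p : ℝ} (hp : p ≤ 1) (k : ℕ) : (1 - p) ^ k ≤ Real.exp (-(p * k)) := by
  rw [mul_comm, ← mul_neg, Real.exp_nat_mul]
  exact pow_le_pow_left₀ (by linarith) (Real.one_sub_le_exp_neg p) k

/-- For `0 ≤ p ≤ 1 / 2`, `exp (2 * p) ≥ 1 + 2 * p ≥ 1 / (1 - p)`. -/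
lemma exp_le_one_sub_pow {p : ℝ} (hp0 : 0 ≤ p) (hp : p ≤ 1 / 2) (k : ℕ) :
    Real.exp (-(2 * p * k)) ≤ (1 - p) ^ k := by
  rw [mul_comm, ← mul_neg, Real.exp_nat_mul]
  refine pow_le_pow_left₀ (Real.exp_pos _).le ?_ k
  rw [Real.exp_neg]
  have h1 := Real.add_one_le_exp (2 * p)
  rw [inv_le_comm₀ (Real.exp_pos _) (by linarith)]
  refine le_trans ?_ h1
  rw [inv_le_comm₀ (by linarith) (by linarith), inv_le_iff_one_le_mul₀ (by linarith)]
  nlinarith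

lemma edgeProb_mul {N : ℕ} (hN : N ≠ 0) (k : ℕ) :
    (edgeProb N : ℝ) * (N ^ 70 * k : ℕ) = k := by
  have : (N : ℝ) ≠ 0 := by exact_mod_cast hN
  simp only [edgeProb]
  push_cast
  field_simp

lemma edgeProb_le_one (N : ℕ) : (edgeProb N : ℝ) ≤ 1 := (edgeProb N).2.2

lemma edgeProb_nonneg (N : ℕ) : 0 ≤ (edgeProb N : ℝ) := (edgeProb N).2.1

lemma nbrsIn_mono {V : Type*} {G : SimpleGraph V} {X Y : Finset V} (h : X ⊆ Y) (y : V) :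
    G.nbrsIn X y ⊆ G.nbrsIn Y y := fun x hx ↦ by
  rw [mem_nbrsIn] at hx ⊢
  exact ⟨h hx.1, hx.2⟩

/-- With high probability there are few labelled short cycles. -/
lemma whp_shortCycleCount_lt : Whp fun N G ↦ G.shortCycleCount < N ^ 71 := by
  have hu : Tendsto (fun N : ℕ ↦ (5 : ℝ) / N) atTop (𝓝 0) :=
    tendsto_const_div_atTop_nhds_zero_nat 5
  refine Whp.of_le hu ?_
  filter_upwards [eventually_ge_atTop 1] with N hN
  have hN0 : (0 : ℝ) < N := by exact_mod_cast hN
  have hN1 : (1 : ℝ) ≤ N := by exact_mod_cast hN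
  have h := mul_edgeMeasure_real_shortCycleCount_le (V := Fin (N ^ 80)) (p := edgeProb N)
    (c := (N : ℝ) ^ 71)
  have hset : {ω : Sym2 (Fin (N ^ 80)) → Bool | ¬ (markedGraph ω).shortCycleCount < N ^ 71} =
      {ω | (N : ℝ) ^ 71 ≤ (markedGraph ω).shortCycleCount} := by
    ext ω
    simp only [Set.mem_ofPred_eq, not_lt]
    exact_mod_cast Iff.rfl
  rw [hset]
  have hd : ((Fintype.card (Fin (N ^ 80)) : ℝ) * edgeProb N) = (N : ℝ) ^ 10 := by
    rw [Fintype.card_fin]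
    simp only [edgeProb]
    push_cast
    field_simp
  rw [hd] at h
  -- The cycles of length 7 dominate, with expected number at most `(N ^ 10) ^ 7`; the extra factor
  -- `N` in the threshold beats this.
  have hsum : ∑ m ∈ range 5, ((N : ℝ) ^ 10) ^ (m + 3) ≤ 5 * (N : ℝ) ^ 70 := by
    refine (Finset.sum_le_card_nsmul _ _ ((N : ℝ) ^ 70) fun m hm ↦ ?_).trans (by simp)
    rw [← pow_mul]
    refine pow_le_pow_right₀ hN1 ?_
    have := Finset.mem_range.1 hm
    omega
  rw [le_div_iff₀ hN0]
  have h3 := h.trans hsum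
  have h4 : (N : ℝ) ^ 71 = N ^ 70 * N := by ring
  rw [h4] at h3
  have h5 : (0 : ℝ) < (N : ℝ) ^ 70 := by positivity
  nlinarith

/-- With high probability independent sets are small. -/
lemma whp_card_indepSet_le : Whp fun N G ↦
    ∀ S : Finset (Fin (N ^ 80)), G.IsIndepSet (S : Set (Fin (N ^ 80))) → S.card ≤ N ^ 71 := by
  have hdiv : Tendsto (fun N : ℕ ↦ ((N / 4 : ℕ) : ℝ)) atTop atTop :=
    tendsto_natCast_atTop_atTop.comp (Nat.tendsto_div_const_atTop (by norm_num))
  have hu : Tendsto (fun N : ℕ ↦ (8 : ℝ) ^ 160 * (((N / 4 : ℕ) : ℝ) ^ 160 *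
      Real.exp (-((N / 4 : ℕ) : ℝ)))) atTop (𝓝 0) := by
    have := ((Real.tendsto_pow_mul_exp_neg_atTop_nhds_zero 160).comp hdiv).const_mul
      ((8 : ℝ) ^ 160)
    simpa using this
  refine Whp.of_le hu ?_
  filter_upwards [eventually_ge_atTop 4, hu.eventually (gt_mem_nhds one_pos)] with N hN hu1
  set j := N / 4 with hj
  have hj1 : 1 ≤ j := by omega
  -- Two disjoint `k`-subsets of a large independent set span no edge between them. Since `p * k =
  -- j`, the union bound is `(N ^ 160 * exp (-j)) ^ k`, whose base tends to 0 because `N ≤ 8 * j`.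
  set k := N ^ 70 * j with hk
  have hk1 : k ≠ 0 := by positivity
  refine (measureReal_mono ?_ (measure_ne_top _ _)).trans
    ((edgeMeasure_real_exists_le (V := Fin (N ^ 80)) (p := edgeProb N) (fun c ↦ c = 0) (k := k) k
      (t := Real.exp (-(j : ℝ))) (Real.exp_pos _).le fun X y hX hy ↦ ?_).trans ?_)
  · intro ω hω
    simp only [Set.mem_ofPred_eq, not_forall, not_le] at hω
    obtain ⟨S, hS, hcard⟩ := hω
    have h2k : k + k ≤ S.card := by
      have h4 : 4 * j ≤ N := by omega
      have : k * 4 ≤ N ^ 71 := by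
        rw [hk, pow_succ, mul_assoc, mul_comm j]
        exact Nat.mul_le_mul_left _ h4
      omega
    obtain ⟨X, hXS, hX⟩ := Finset.exists_subset_card_eq (show k ≤ S.card by omega)
    have hcard' : k ≤ (S \ X).card := by
      rw [Finset.card_sdiff_of_subset hXS]; omega
    obtain ⟨Y, hYS, hY⟩ := Finset.exists_subset_card_eq hcard'
    refine ⟨X, Y, hX, hY, (Finset.disjoint_sdiff (s := X) (t := S)).mono_right hYS, fun y hy ↦ ?_⟩
    rw [Finset.card_eq_zero, Finset.eq_empty_iff_forall_notMem]
    intro x hx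
    rw [mem_nbrsIn] at hx
    exact hS (Finset.mem_coe.2 (Finset.mem_sdiff.1 (hYS hy)).1) (Finset.mem_coe.2 (hXS hx.1))
      hx.2.ne hx.2
  · rw [edgeMeasure_real_card_nbrsIn_eq_zero hy, hX]
    refine (one_sub_pow_le_exp (edgeProb_le_one N) k).trans_eq ?_
    rw [hk, edgeProb_mul (by omega)]
  · rw [Fintype.card_fin]
    have hch : (((N ^ 80).choose k : ℕ) : ℝ) ≤ ((N : ℝ) ^ 80) ^ k := by
      exact_mod_cast Nat.choose_le_pow (N ^ 80) k
    have hle : (N : ℝ) ≤ 8 * j := by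
      have : N ≤ 8 * j := by omega
      exact_mod_cast this
    calc (((N ^ 80).choose k : ℕ) : ℝ) * (((N ^ 80).choose k : ℕ) : ℝ) * Real.exp (-(j : ℝ)) ^ k
        ≤ ((N : ℝ) ^ 80) ^ k * ((N : ℝ) ^ 80) ^ k * Real.exp (-(j : ℝ)) ^ k := by gcongr
      _ = ((N : ℝ) ^ 160 * Real.exp (-(j : ℝ))) ^ k := by
          rw [← mul_pow, ← mul_pow]; ring
      _ ≤ ((8 * j : ℝ) ^ 160 * Real.exp (-(j : ℝ))) ^ k := by gcongr
      _ = ((8 : ℝ) ^ 160 * ((j : ℝ) ^ 160 * Real.exp (-(j : ℝ)))) ^ k := by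
          rw [mul_pow (8 : ℝ), mul_assoc]
      _ ≤ (8 : ℝ) ^ 160 * ((j : ℝ) ^ 160 * Real.exp (-(j : ℝ))) :=
          pow_le_of_le_one (by positivity) hu1.le hk1

end Asymptotics

/-- With high probability there is no dense spot. -/
lemma whp_noDenseSpot : Whp fun N G ↦ G.NoDenseSpot ((N : ℝ) ^ 71) ((N : ℝ) ^ 7) := by
  refine Whp.of_le (tendsto_const_div_atTop_nhds_zero_nat 4) ?_
  filter_upwards [eventually_ge_atTop 3] with N hN
  have hN3 : (3 : ℝ) ≤ N := by exact_mod_cast hN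
  have hN0 : (0 : ℝ) < N := by linarith
  have hN1 : (1 : ℝ) ≤ N := by linarith
  let P : Finset (ℕ × ℕ) := (range (N ^ 80 + 1) ×ˢ range (N ^ 80 + 1)).filter fun c ↦
    c.1 ≠ 0 ∧ c.1 * N ^ 7 ≤ c.2 ∧ c.2 ≤ N ^ 71
  let E : ℕ × ℕ → Set (Sym2 (Fin (N ^ 80)) → Bool) := fun c ↦
    {ω | ∃ X Y : Finset (Fin (N ^ 80)), X.card = c.1 ∧ Y.card = c.2 ∧ Disjoint X Y ∧
      ∀ y ∈ Y, 2 ≤ ((markedGraph ω).nbrsIn X y).card}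
  have hsub : {ω | ¬ (markedGraph ω).NoDenseSpot ((N : ℝ) ^ 71) ((N : ℝ) ^ 7)} ⊆
      ⋃ c ∈ P, E c := by
    intro ω hω
    simp only [NoDenseSpot, Set.mem_ofPred_eq, not_forall, not_exists, not_and, not_le] at hω
    obtain ⟨X, Y, hXY, ⟨y, hy⟩, hXq, hYm, hdeg⟩ := hω
    rw [Set.mem_iUnion₂]
    refine ⟨(X.card, Y.card), ?_, X, Y, rfl, rfl, hXY, hdeg⟩
    have hcard : ∀ Z : Finset (Fin (N ^ 80)), Z.card < N ^ 80 + 1 := fun Z ↦ by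
      have := Finset.card_le_univ Z
      rw [Fintype.card_fin] at this
      omega
    refine Finset.mem_filter.2 ⟨Finset.mem_product.2 ⟨Finset.mem_range.2 (hcard X),
      Finset.mem_range.2 (hcard Y)⟩, ?_, by exact_mod_cast hXq, by exact_mod_cast hYm⟩
    have h1 := hdeg y hy
    have h2 : ((markedGraph ω).nbrsIn X y).card ≤ X.card :=
      Finset.card_le_card fun z hz ↦ (mem_nbrsIn.1 hz).1
    simp only
    omega
  have hle : ∀ c ∈ P, (edgeMeasure (Fin (N ^ 80)) (edgeProb N)).real (E c) ≤
      (1 / (N : ℝ)) ^ 162 := by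
    rintro ⟨a, b⟩ hc
    obtain ⟨ha, hab, hb⟩ := (Finset.mem_filter.1 hc).2
    simp only at ha hab hb
    have hN7 : 162 ≤ N ^ 7 := le_trans (by norm_num) (Nat.pow_le_pow_left hN 7)
    -- With this, a bound `(1 / N) ^ b` outweighs the at most `(2 * N ^ 80) ^ 2` choices of the two
    -- sizes.
    have hb162 : 162 ≤ b := hN7.trans ((Nat.le_mul_of_pos_left _ (Nat.pos_of_ne_zero ha)).trans hab)
    have h80 : 80 * a ≤ b := by nlinarith
    have hab' : (a : ℝ) * N ^ 7 ≤ b := by exact_mod_cast hab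
    have hb' : (b : ℝ) ≤ N ^ 71 := by exact_mod_cast hb
    have hb0 : (0 : ℝ) < b := by exact_mod_cast (by omega : 0 < b)
    -- `x` is the density of `Y`: `x ^ b` cancels the number of choices of `Y` up to `3 ^ b`. The
    -- remaining factor `N⁻³` per vertex pays for the `3` and for the choices of `X`, at most `N ^
    -- b`.
    set x : ℝ := b / N ^ 80 with hx
    have hx0 : 0 < x := by positivity
    refine (edgeMeasure_real_exists_le (V := Fin (N ^ 80)) (p := edgeProb N) (fun c ↦ 2 ≤ c)
      (k := a) b (t := x * (1 / N ^ 3)) (by positivity) fun X y hX _ ↦ ?_).trans ?_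
    · refine (edgeMeasure_real_two_le_card_nbrsIn X y).trans ?_
      rw [hX]
      simp only [edgeProb]
      have h1 : ((a : ℝ) * N ^ 7) ^ 2 ≤ (b : ℝ) * (N : ℝ) ^ 71 := by
        calc ((a : ℝ) * (N : ℝ) ^ 7) ^ 2 ≤ (b : ℝ) ^ 2 := by gcongr
          _ = (b : ℝ) * b := sq _
          _ ≤ (b : ℝ) * (N : ℝ) ^ 71 := by gcongr
      have h2 : ((a : ℝ) * ((N : ℝ) ^ 70)⁻¹) ^ 2 = ((a : ℝ) * N ^ 7) ^ 2 / N ^ 154 := by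
        field_simp
      have h3 : x * (1 / (N : ℝ) ^ 3) = b * N ^ 71 / N ^ 154 := by
        rw [hx]; field_simp
      rw [h2, h3]
      gcongr
    · rw [Fintype.card_fin]
      have hch : (((N ^ 80).choose a : ℕ) : ℝ) ≤ (N : ℝ) ^ b := by
        calc (((N ^ 80).choose a : ℕ) : ℝ) ≤ ((N : ℝ) ^ 80) ^ a := by
              exact_mod_cast Nat.choose_le_pow (N ^ 80) a
          _ = (N : ℝ) ^ (80 * a) := (pow_mul _ _ _).symm
          _ ≤ (N : ℝ) ^ b := pow_le_pow_right₀ hN1 h80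
      have hch2 : (((N ^ 80).choose b : ℕ) : ℝ) * x ^ b ≤ 3 ^ b := by
        refine (choose_mul_pow_le_exp (N ^ 80) b hx0.le).trans ?_
        have hxn : x * ((N ^ 80 : ℕ) : ℝ) = b * 1 := by
          rw [hx]; push_cast; field_simp
        rw [hxn, Real.exp_nat_mul]
        exact pow_le_pow_left₀ (Real.exp_pos _).le Real.exp_one_lt_three.le b
      calc (((N ^ 80).choose a : ℕ) : ℝ) * (((N ^ 80).choose b : ℕ) : ℝ) * (x * (1 / N ^ 3)) ^ b
          = (((N ^ 80).choose a : ℕ) : ℝ) * ((((N ^ 80).choose b : ℕ) : ℝ) * x ^ b) *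
            (1 / N ^ 3) ^ b := by rw [mul_pow]; ring
        _ ≤ (N : ℝ) ^ b * 3 ^ b * (1 / N ^ 3) ^ b := by gcongr
        _ = (3 / N * (1 / N)) ^ b := by
            rw [← mul_pow, ← mul_pow]; congr 1; field_simp
        _ ≤ (1 / N) ^ b := by
            refine pow_le_pow_left₀ (by positivity) ?_ b
            refine mul_le_of_le_one_left (by positivity) ?_
            rwa [div_le_one hN0]
        _ ≤ (1 / (N : ℝ)) ^ 162 :=
            pow_le_pow_of_le_one (by positivity) ((div_le_one hN0).2 hN1) hb162
  refine (measureReal_mono hsub (measure_ne_top _ _)).trans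
    ((measureReal_biUnion_finset_le _ _).trans ((Finset.sum_le_card_nsmul _ _ _ hle).trans ?_))
  have hP : (P.card : ℝ) ≤ (2 * N ^ 80) * (2 * N ^ 80) := by
    have h1 : P.card ≤ (N ^ 80 + 1) * (N ^ 80 + 1) :=
      (Finset.card_filter_le _ _).trans (by simp)
    have h2 : (P.card : ℝ) ≤ (N ^ 80 + 1) * (N ^ 80 + 1) := by exact_mod_cast h1
    have h3 : (1 : ℝ) ≤ N ^ 80 := one_le_pow₀ hN1
    refine h2.trans ?_
    gcongr <;> linarith
  rw [nsmul_eq_mul]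
  calc (P.card : ℝ) * (1 / (N : ℝ)) ^ 162 ≤
          (2 * (N : ℝ) ^ 80) * (2 * (N : ℝ) ^ 80) * (1 / (N : ℝ)) ^ 162 := by
        gcongr
    _ = 4 / (N : ℝ) * (1 / N) := by field_simp; norm_num
    _ ≤ 4 / (N : ℝ) := mul_le_of_le_one_right (by positivity) ((div_le_one hN0).2 hN1)

/-! ### Domination in the random graph -/

/-- With high probability there is an edge between any set of `K * N ^ 70` vertices and any
disjoint set that contains a fraction `ε` of the vertices, if `K * ε` is not too small. -/
lemma whp_exists_edge {K : ℕ} {ε : ℝ} (hK : 2 ≤ K * ε) : Whp fun N G ↦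
    ∀ X Y : Finset (Fin (N ^ 80)), X.card = N ^ 70 * K → Y.card = ⌈ε * (N : ℝ) ^ 80⌉₊ →
      Disjoint X Y → ∃ y ∈ Y, (G.nbrsIn X y).card ≠ 0 := by
  -- Choosing `X` and `Y` costs at most `2 ^ (N ^ 80)` each, while having no edge between them has
  -- probability at most `exp (-2 * N ^ 80)`.
  have hc : (0 : ℝ) < 2 - 2 * Real.log 2 := by
    have := Real.log_two_lt_d9
    linarith
  set c := 2 - 2 * Real.log 2 with hcdef
  have hu : Tendsto (fun N : ℕ ↦ Real.exp (-(c * (N : ℝ) ^ 80))) atTop (𝓝 0) := by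
    refine Real.tendsto_exp_neg_atTop_nhds_zero.comp ?_
    exact ((tendsto_pow_atTop (by norm_num)).comp tendsto_natCast_atTop_atTop).const_mul_atTop hc
  refine Whp.of_le hu ?_
  filter_upwards [eventually_ge_atTop 1] with N hN
  set l := ⌈ε * (N : ℝ) ^ 80⌉₊ with hl
  have hsub : {ω : Sym2 (Fin (N ^ 80)) → Bool | ¬ ∀ X Y : Finset (Fin (N ^ 80)),
      X.card = N ^ 70 * K → Y.card = l → Disjoint X Y →
        ∃ y ∈ Y, ((markedGraph ω).nbrsIn X y).card ≠ 0} ⊆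
      {ω | ∃ X Y : Finset (Fin (N ^ 80)), X.card = N ^ 70 * K ∧ Y.card = l ∧ Disjoint X Y ∧
        ∀ y ∈ Y, ((markedGraph ω).nbrsIn X y).card = 0} := by
    intro ω hω
    simp only [Set.mem_ofPred_eq, not_forall, not_exists, not_and, not_not] at hω ⊢
    obtain ⟨X, Y, hX, hY, hXY, h⟩ := hω
    exact ⟨X, Y, hX, hY, hXY, h⟩
  refine (measureReal_mono hsub (measure_ne_top _ _)).trans
    ((edgeMeasure_real_exists_le (V := Fin (N ^ 80)) (p := edgeProb N) (fun c ↦ c = 0) l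
      (t := Real.exp (-(K : ℝ))) (Real.exp_pos _).le fun X y hX hy ↦ ?_).trans ?_)
  · rw [edgeMeasure_real_card_nbrsIn_eq_zero hy, hX]
    refine (one_sub_pow_le_exp (edgeProb_le_one N) _).trans_eq ?_
    rw [edgeProb_mul (by omega)]
  · rw [Fintype.card_fin]
    have hch : ∀ k, (((N ^ 80).choose k : ℕ) : ℝ) ≤ Real.exp (Real.log 2 * (N : ℝ) ^ 80) := by
      intro k
      have h1 : (((N ^ 80).choose k : ℕ) : ℝ) ≤ 2 ^ (N ^ 80) := by
        exact_mod_cast Nat.choose_le_two_pow (N ^ 80) k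
      refine h1.trans_eq ?_
      have h2 : (N : ℝ) ^ 80 = ((N ^ 80 : ℕ) : ℝ) := by push_cast; rfl
      rw [h2, mul_comm, Real.exp_nat_mul, Real.exp_log (by norm_num)]
    have hexp : Real.exp (-(K : ℝ)) ^ l ≤ Real.exp (-(2 * (N : ℝ) ^ 80)) := by
      rw [← Real.exp_nat_mul]
      refine Real.exp_le_exp.2 ?_
      have h1 : ε * (N : ℝ) ^ 80 ≤ l := Nat.le_ceil _
      have h2 : (K : ℝ) * (ε * (N : ℝ) ^ 80) ≤ K * l := by gcongr
      have h3 : (0 : ℝ) ≤ (N : ℝ) ^ 80 := by positivity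
      nlinarith
    calc (((N ^ 80).choose (N ^ 70 * K) : ℕ) : ℝ) * (((N ^ 80).choose l : ℕ) : ℝ) *
          Real.exp (-(K : ℝ)) ^ l
        ≤ Real.exp (Real.log 2 * (N : ℝ) ^ 80) * Real.exp (Real.log 2 * (N : ℝ) ^ 80) *
          Real.exp (-(2 * (N : ℝ) ^ 80)) := by gcongr <;> apply hch
      _ = Real.exp (-(c * (N : ℝ) ^ 80)) := by
          rw [← Real.exp_add, ← Real.exp_add, hcdef]
          congr 1
          ring

lemma eventually_mul_pow_le_mul_pow (C : ℝ) {δ : ℝ} (hδ : 0 < δ) :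
    ∀ᶠ N : ℕ in atTop, C * (N : ℝ) ^ 71 ≤ δ * (N : ℝ) ^ 80 := by
  filter_upwards [eventually_ge_atTop ⌈C / δ⌉₊, eventually_ge_atTop 1] with N hN hN1
  have hN1' : (1 : ℝ) ≤ N := by exact_mod_cast hN1
  have h1 : C / δ ≤ N := (Nat.le_ceil _).trans (by exact_mod_cast hN)
  rw [div_le_iff₀ hδ] at h1
  calc C * (N : ℝ) ^ 71 ≤ N * δ * (N : ℝ) ^ 71 := by gcongr
    _ = δ * (N : ℝ) ^ 72 := by ring
    _ ≤ δ * (N : ℝ) ^ 80 := by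
      have := pow_le_pow_right₀ hN1' (show 72 ≤ 80 by norm_num)
      gcongr

/-- With high probability every set of `K * N ^ 70` vertices leaves a positive fraction of the
vertices undominated. -/
lemma exists_whp_lt_card_fewNbrs (K : ℕ) : ∃ ε > 0, Whp fun N G ↦
    ∀ X : Finset (Fin (N ^ 80)), X.card = N ^ 70 * K →
      ε * (N : ℝ) ^ 80 < (G.fewNbrs X 0).card := by
  classical
  set c : ℝ := Real.exp (-(2 * K)) with hc
  have hc0 : 0 < c := Real.exp_pos _
  have hc1 : c ≤ 1 := Real.exp_le_one_iff.2 (by simp)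
  -- `c` bounds from below the probability that a given vertex outside `X` is undominated. With `n =
  -- N ^ 80`, this `ε` keeps the number of sets of size about `2 * ε * n` below `exp (c * n / 4)`,
  -- against a probability at most `exp (-c * n / 2)`.
  set ε : ℝ := c ^ 2 / 128 with hε
  have hε0 : 0 < ε := by positivity
  have hε1 : ε ≤ 1 / 128 := by
    rw [hε]
    have : c ^ 2 ≤ 1 := pow_le_one₀ hc0.le hc1
    linarith
  refine ⟨ε, hε0, ?_⟩
  have hu : Tendsto (fun N : ℕ ↦ Real.exp (-(c / 8 * (N : ℝ) ^ 80))) atTop (𝓝 0) := by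
    refine Real.tendsto_exp_neg_atTop_nhds_zero.comp ?_
    exact ((tendsto_pow_atTop (by norm_num)).comp tendsto_natCast_atTop_atTop).const_mul_atTop
      (by positivity)
  refine Whp.of_le hu ?_
  filter_upwards [eventually_ge_atTop 2, eventually_mul_pow_le_mul_pow (80 * K)
    (show 0 < c / 8 by positivity), eventually_mul_pow_le_mul_pow K hε0] with N hN hN2 hN3
  have hN1 : (1 : ℝ) ≤ N := by exact_mod_cast (by omega : 1 ≤ N)
  have hNn : (0 : ℝ) ≤ (N : ℝ) ^ 80 := by positivity
  set k := N ^ 70 * K with hk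
  -- One `ε` is for the undominated vertices, the other for `X` itself.
  set u := ⌊2 * ε * (N : ℝ) ^ 80⌋₊ with hudef
  have hu2 : (u : ℝ) ≤ 2 * ε * (N : ℝ) ^ 80 := Nat.floor_le (by positivity)
  have hun : u ≤ N ^ 80 := by
    have : (u : ℝ) ≤ ((N ^ 80 : ℕ) : ℝ) := by
      push_cast
      nlinarith
    exact_mod_cast this
  have hkε : (k : ℝ) ≤ ε * (N : ℝ) ^ 80 := by
    refine le_trans ?_ hN3
    rw [hk]
    push_cast
    have : (N : ℝ) ^ 70 ≤ (N : ℝ) ^ 71 := pow_le_pow_right₀ hN1 (by norm_num)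
    rw [mul_comm]
    gcongr
  refine (measureReal_mono ?_ (measure_ne_top _ _)).trans
    ((edgeMeasure_real_exists_le (V := Fin (N ^ 80)) (p := edgeProb N) (fun d ↦ d ≠ 0) (k := k)
      (N ^ 80 - u) (t := Real.exp (-c)) (Real.exp_pos _).le fun X y hX hy ↦ ?_).trans ?_)
  · intro ω hω
    simp only [Set.mem_ofPred_eq, not_forall, not_lt] at hω
    obtain ⟨X, hX, hfew⟩ := hω
    have hcompl : N ^ 80 - u ≤ ((X ∪ (markedGraph ω).fewNbrs X 0)ᶜ).card := by
      rw [Finset.card_compl, Fintype.card_fin]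
      refine Nat.sub_le_sub_left ((Finset.card_union_le _ _).trans (Nat.le_floor ?_)) _
      push_cast
      rw [hX]
      linarith
    obtain ⟨Y, hYs, hY⟩ := Finset.exists_subset_card_eq hcompl
    have hmem : ∀ y ∈ Y, y ∉ X ∧ y ∉ (markedGraph ω).fewNbrs X 0 := fun y hy ↦ by
      have := hYs hy
      rw [Finset.mem_compl, Finset.mem_union, not_or] at this
      exact this
    refine ⟨X, Y, hX, hY, Finset.disjoint_right.2 fun y hy ↦ (hmem y hy).1, fun y hy h0 ↦ ?_⟩
    exact (hmem y hy).2 (mem_fewNbrs.2 ⟨(hmem y hy).1, h0.le⟩)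
  · rw [edgeMeasure_real_card_nbrsIn_ne_zero hy, hX]
    have hp : (edgeProb N : ℝ) ≤ 1 / 2 := by
      simp only [edgeProb]
      rw [inv_le_comm₀ (by positivity) (by norm_num)]
      have h2 : (2 : ℝ) ≤ N := by exact_mod_cast hN
      calc ((1 / 2 : ℝ))⁻¹ = 2 := by norm_num
        _ ≤ N := h2
        _ ≤ (N : ℝ) ^ 70 := le_self_pow₀ hN1 (by norm_num)
    have h1 := exp_le_one_sub_pow (edgeProb_nonneg N) hp k
    rw [mul_assoc, hk, edgeProb_mul (by omega), ← hc, ← hk] at h1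
    have h2 := Real.one_sub_le_exp_neg c
    linarith
  · rw [Fintype.card_fin, Nat.choose_symm hun]
    have hchk : (((N ^ 80).choose k : ℕ) : ℝ) ≤ Real.exp (c / 8 * (N : ℝ) ^ 80) := by
      calc (((N ^ 80).choose k : ℕ) : ℝ) ≤ ((N : ℝ) ^ 80) ^ k := by
            exact_mod_cast Nat.choose_le_pow (N ^ 80) k
        _ = (N : ℝ) ^ (80 * k) := (pow_mul _ _ _).symm
        _ ≤ Real.exp N ^ (80 * k) := by
            gcongr
            linarith [Real.add_one_le_exp (N : ℝ)]
        _ = Real.exp (80 * K * (N : ℝ) ^ 71) := by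
            rw [← Real.exp_nat_mul, hk]
            push_cast
            congr 1
            ring
        _ ≤ Real.exp (c / 8 * (N : ℝ) ^ 80) := Real.exp_le_exp.2 hN2
    have hchu : (((N ^ 80).choose u : ℕ) : ℝ) ≤ Real.exp (c / 4 * (N : ℝ) ^ 80) := by
      have h1 := choose_mul_pow_le_exp (N ^ 80) u (x := c / 8) (by positivity)
      rw [← le_div_iff₀ (by positivity)] at h1
      refine h1.trans ?_
      rw [div_eq_mul_inv, ← inv_pow, inv_div]
      have h2 : (8 / c) ^ u ≤ Real.exp (c / 8 * (N : ℝ) ^ 80) := by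
        calc (8 / c) ^ u ≤ Real.exp (8 / c) ^ u := by
              gcongr
              linarith [Real.add_one_le_exp (8 / c)]
          _ = Real.exp (u * (8 / c)) := (Real.exp_nat_mul _ _).symm
          _ ≤ Real.exp (2 * ε * (N : ℝ) ^ 80 * (8 / c)) := by gcongr
          _ = Real.exp (c / 8 * (N : ℝ) ^ 80) := by
              congr 1
              rw [hε]
              field_simp
              norm_num
      calc Real.exp (c / 8 * ((N ^ 80 : ℕ) : ℝ)) * (8 / c) ^ u
          ≤ Real.exp (c / 8 * ((N ^ 80 : ℕ) : ℝ)) * Real.exp (c / 8 * (N : ℝ) ^ 80) := by gcongr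
        _ = Real.exp (c / 4 * (N : ℝ) ^ 80) := by
            rw [← Real.exp_add]
            push_cast
            congr 1
            ring
    have hexp : Real.exp (-c) ^ (N ^ 80 - u) ≤ Real.exp (-(c / 2 * (N : ℝ) ^ 80)) := by
      rw [← Real.exp_nat_mul]
      refine Real.exp_le_exp.2 ?_
      rw [Nat.cast_sub hun]
      push_cast
      have h1 : (u : ℝ) ≤ (N : ℝ) ^ 80 / 2 := by nlinarith
      nlinarith
    calc (((N ^ 80).choose k : ℕ) : ℝ) * (((N ^ 80).choose u : ℕ) : ℝ) *
          Real.exp (-c) ^ (N ^ 80 - u)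
        ≤ Real.exp (c / 8 * (N : ℝ) ^ 80) * Real.exp (c / 4 * (N : ℝ) ^ 80) *
          Real.exp (-(c / 2 * (N : ℝ) ^ 80)) := by gcongr
      _ = Real.exp (-(c / 8 * (N : ℝ) ^ 80)) := by
          rw [← Real.exp_add, ← Real.exp_add]
          congr 1
          ring

/-- For every `ε'` there is `ε` such that, with high probability, sets of vertices dominating all but
a fraction `ε` of the vertices dominate twice all but a fraction `ε'`. -/
lemma exists_whp_dominatesTwice {ε' : ℝ} (hε' : 0 < ε') :
    ∃ ε > 0, ε ≤ ε' ∧ Whp fun _ G ↦ G.DominatesTwice ε ε' := by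
  classical
  obtain ⟨K, hK⟩ := exists_nat_ge (4 / ε')
  rw [div_le_iff₀ hε'] at hK
  obtain ⟨ε, hε0, hε⟩ := exists_whp_lt_card_fewNbrs (2 * K)
  refine ⟨min ε ε', lt_min hε0 hε', min_le_right _ _, ?_⟩
  have hedge := whp_exists_edge (K := K) (ε := ε' / 2) (by linarith)
  refine (hε.and hedge).mono ?_
  filter_upwards [eventually_ge_atTop 1, eventually_mul_pow_le_mul_pow (2 * K) one_pos]
    with N hN hNK G ⟨hG1, hG2⟩ X hX
  have hN1 : (1 : ℝ) ≤ N := by exact_mod_cast hN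
  rw [Fintype.card_fin] at hX ⊢
  push_cast at hX ⊢
  rcases lt_or_ge X.card (N ^ 70 * (2 * K)) with hlt | hge
  · exfalso
    have hKn : N ^ 70 * (2 * K) ≤ Fintype.card (Fin (N ^ 80)) := by
      rw [Fintype.card_fin]
      have h1 : (N : ℝ) ^ 70 ≤ (N : ℝ) ^ 71 := pow_le_pow_right₀ hN1 (by norm_num)
      have h2 : ((N ^ 70 * (2 * K) : ℕ) : ℝ) ≤ ((N ^ 80 : ℕ) : ℝ) := by
        push_cast
        have h3 : (N : ℝ) ^ 70 * (2 * K) ≤ (N : ℝ) ^ 71 * (2 * K) := by gcongr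
        linarith
      exact_mod_cast h2
    -- A set this small, enlarged to the exact size, would still leave too many vertices
    -- undominated.
    obtain ⟨X', hXX', hX'⟩ := Finset.exists_superset_card_eq hlt.le hKn
    have h1 := hG1 X' hX'
    have hsub : G.fewNbrs X' 0 ⊆ G.fewNbrs X 0 := by
      intro y hy
      rw [mem_fewNbrs] at hy ⊢
      exact ⟨fun h ↦ hy.1 (hXX' h), (Finset.card_le_card (nbrsIn_mono hXX' y)).trans hy.2⟩
    have h2 : ((G.fewNbrs X' 0).card : ℝ) ≤ (G.fewNbrs X 0).card := by
      exact_mod_cast Finset.card_le_card hsub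
    have h3 : min ε ε' * (N : ℝ) ^ 80 ≤ ε * (N : ℝ) ^ 80 := by
      gcongr
      exact min_le_left _ _
    linarith
  · have hund : ∀ Z ⊆ X, Z.card = N ^ 70 * K →
        ((univ.filter fun y ↦ y ∉ X ∧ (G.nbrsIn Z y).card = 0).card : ℝ) ≤
          ε' / 2 * (N : ℝ) ^ 80 := by
      intro Z hZX hZ
      by_contra hcon
      obtain ⟨Y, hYs, hY⟩ := Finset.exists_subset_card_eq (Nat.ceil_le.2 (not_le.1 hcon).le)
      obtain ⟨y, hy, hy0⟩ := hG2 Z Y hZ hY (Finset.disjoint_right.2 fun y hy hyZ ↦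
        (Finset.mem_filter.1 (hYs hy)).2.1 (hZX hyZ))
      exact hy0 (Finset.mem_filter.1 (hYs hy)).2.2
    -- Two disjoint parts of `X` each dominate all but a fraction `ε' / 2` of the vertices outside
    -- `X`, and a vertex with at most one neighbour in `X` is missed by one of them.
    obtain ⟨Z, hZX, hZ⟩ := Finset.exists_subset_card_eq (show N ^ 70 * K ≤ X.card by
      rw [mul_left_comm] at hge; omega)
    have hcard' : N ^ 70 * K ≤ (X \ Z).card := by
      rw [Finset.card_sdiff_of_subset hZX, hZ]
      rw [mul_left_comm] at hge
      omega
    obtain ⟨Z', hZ'X, hZ'⟩ := Finset.exists_subset_card_eq hcard'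
    have hsub : G.fewNbrs X 1 ⊆ (univ.filter fun y ↦ y ∉ X ∧ (G.nbrsIn Z y).card = 0) ∪
        univ.filter fun y ↦ y ∉ X ∧ (G.nbrsIn Z' y).card = 0 := by
      intro y hy
      rw [mem_fewNbrs] at hy
      rw [Finset.mem_union, Finset.mem_filter, Finset.mem_filter]
      have hdisj : Disjoint (G.nbrsIn Z y) (G.nbrsIn Z' y) := by
        rw [Finset.disjoint_left]
        intro x hx hx'
        exact (Finset.mem_sdiff.1 (hZ'X (mem_nbrsIn.1 hx').1)).2 (mem_nbrsIn.1 hx).1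
      have hle : (G.nbrsIn Z y).card + (G.nbrsIn Z' y).card ≤ 1 := by
        rw [← Finset.card_union_of_disjoint hdisj]
        exact (Finset.card_le_card (Finset.union_subset (nbrsIn_mono hZX y)
          (nbrsIn_mono (hZ'X.trans Finset.sdiff_subset) y))).trans hy.2
      rcases Nat.eq_zero_or_pos (G.nbrsIn Z y).card with h | h
      · exact Or.inl ⟨Finset.mem_univ _, hy.1, h⟩
      · exact Or.inr ⟨Finset.mem_univ _, hy.1, by omega⟩
    have h1 := (Finset.card_le_card hsub).trans (Finset.card_union_le _ _)
    have h2 : ((G.fewNbrs X 1).card : ℝ) ≤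
        (univ.filter fun y ↦ y ∉ X ∧ (G.nbrsIn Z y).card = 0).card +
        (univ.filter fun y ↦ y ∉ X ∧ (G.nbrsIn Z' y).card = 0).card := by exact_mod_cast h1
    have h3 := hund Z hZX hZ
    have h4 := hund Z' (hZ'X.trans Finset.sdiff_subset) hZ'
    linarith

lemma exists_seq_whp_dominatesTwice (k : ℕ) : ∃ e : ℕ → ℝ, e 0 = 1 / 2 ∧ (∀ j, 0 < e j) ∧
    (∀ j, 3 * e (j + 1) ≤ e j) ∧
    Whp fun _ G ↦ ∀ j < k, G.DominatesTwice (e (j + 1)) (e j / 3) := by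
  choose! g hg0 hgle hgwhp using fun (ε' : ℝ) (h : 0 < ε') ↦ exists_whp_dominatesTwice h
  -- Peeling runs from `e k` down to `e 0`, so each fraction is chosen in terms of the larger one
  -- that it must lead to.
  let e : ℕ → ℝ := fun j ↦ Nat.rec (1 / 2) (fun _ x ↦ g (x / 3)) j
  have he_succ : ∀ j, e (j + 1) = g (e j / 3) := fun j ↦ rfl
  have hepos : ∀ j, 0 < e j := by
    intro j
    induction j with
    | zero => norm_num [e]
    | succ j ih => rw [he_succ]; exact hg0 _ (by positivity)
  refine ⟨e, rfl, hepos, fun j ↦ ?_, Whp.forall_lt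
    (P := fun j N G ↦ G.DominatesTwice (e (j + 1)) (e j / 3)) k fun j _ ↦ ?_⟩
  · rw [he_succ]
    have := hgle (e j / 3) (by have := hepos j; positivity)
    linarith
  · rw [he_succ]
    exact hgwhp _ (by have := hepos j; positivity)

/-! ### Choice of parameters and conclusion -/

/-- There is a finite graph of girth at least `8` that is not normal. -/
theorem exists_le_egirth_not_isNormal :
    ∃ (n : ℕ) (G : SimpleGraph (Fin n)), 8 ≤ G.egirth ∧ ¬ G.IsNormal := by
  classical
  obtain ⟨e, he0, hepos, he, hdom⟩ := exists_seq_whp_dominatesTwice 63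
  set δ := e 63 / 2 with hδ
  have hδ0 : 0 < δ := by have := hepos 63; positivity
  obtain ⟨N, ⟨G, hGcyc, hGind, hGdense, hGdom⟩, hN1, hN2, hN3, hN4⟩ :=
    ((whp_shortCycleCount_lt.and (whp_card_indepSet_le.and
      (whp_noDenseSpot.and hdom))).eventually_exists.and ((eventually_ge_atTop 1).and
      ((eventually_ge_atTop (⌈2 / δ⌉₊)).and ((eventually_mul_pow_le_mul_pow 3 hδ0).and
      (eventually_mul_pow_le_mul_pow 2 (show (0 : ℝ) < 1 / 2 by norm_num)))))).exists
  obtain ⟨W, hWcard, hWiso, hWgirth⟩ := exists_induce_le_egirth G hGind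
  have hNr : (1 : ℝ) ≤ N := by exact_mod_cast hN1
  have hNpos : (0 : ℝ) < N := by linarith
  have hNδ : 2 ≤ N * δ := by
    rw [← div_le_iff₀ hδ0]
    exact (Nat.le_ceil _).trans (by exact_mod_cast hN2)
  have hWcard' : ((Fintype.card (Fin (N ^ 80)) : ℕ) : ℝ) ≤ W.card + 2 * (N : ℝ) ^ 71 := by
    have : Fintype.card (Fin (N ^ 80)) ≤ W.card + 2 * N ^ 71 := by omega
    exact_mod_cast this
  have hWne : W.Nonempty := by
    rw [Finset.nonempty_iff_ne_empty]
    intro hW0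
    rw [hW0, Fintype.card_fin] at hWcard'
    push_cast at hWcard'
    have : (0 : ℝ) < (N : ℝ) ^ 80 := by positivity
    rw [Finset.card_empty, Nat.cast_zero] at hWcard'
    linarith
  have hnormal : ¬ (G.induce (W : Set (Fin (N ^ 80)))).IsNormal := by
    -- 63 rounds of factor `N` bring the independence bound `N ^ 71` down to `β = N ^ 8`. Both `β <
    -- s` and `2 * r * q = 2 * N ^ 8 ≤ s` follow from `2 ≤ N * δ`. Of `e 63 = 2 * δ`, one half is
    -- used by `m * s = δ * N ^ 80`, the other absorbs `3 * m`.
    refine not_isNormal_induce (m := (N : ℝ) ^ 71) (q := (N : ℝ) ^ 7) (s := δ * (N : ℝ) ^ 9)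
      (r := N) (β := (N : ℝ) ^ 8) (e := e) (k := 63) hWcard' hWiso
      (cliqueFree_three_of_le_egirth hWgirth) hWne (fun S hS ↦ by exact_mod_cast hGind S hS)
      hGdense (by positivity) ?_ hNr ?_ (by rw [he0]; norm_num) (fun j _ ↦ he j) hGdom (by ring) ?_
    · have h8 : (0 : ℝ) < (N : ℝ) ^ 8 := by positivity
      nlinarith
    · have h8 : (0 : ℝ) < (N : ℝ) ^ 8 := by positivity
      nlinarith
    · rw [Fintype.card_fin]
      push_cast
      have h1 : (N : ℝ) ^ 71 * (δ * (N : ℝ) ^ 9) = δ * (N : ℝ) ^ 80 := by ring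
      have h2 : e 63 = δ + δ := by rw [hδ]; ring
      rw [h1, h2, add_mul]
      linarith
  let φ : G.induce (W : Set (Fin (N ^ 80))) ≃g _ :=
    Iso.map (Fintype.equivFin (W : Set (Fin (N ^ 80)))) (G.induce (W : Set (Fin (N ^ 80))))
  exact ⟨_, _, φ.egirth_eq ▸ hWgirth, fun h ↦ hnormal (h.of_iso φ.symm)⟩

end SimpleGraph

theorem theorem1 :
    (∃ (n : ℕ) (G : SimpleGraph (Fin n)), 8 ≤ G.egirth ∧ ¬ G.IsNormal) ∧
    (∀ {V : Type*} (G : SimpleGraph V), 8 ≤ G.egirth → G.HasNoForbiddenInduced) ∧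
    ¬ SimpleGraph.NormalGraphConjecture := by
  refine ⟨SimpleGraph.exists_le_egirth_not_isNormal,
    fun G hG ↦ SimpleGraph.hasNoForbiddenInduced_of_le_egirth hG, fun h ↦ ?_⟩
  obtain ⟨n, G, hG, hnormal⟩ := SimpleGraph.exists_le_egirth_not_isNormal
  exact hnormal (h (Fin n) G (SimpleGraph.hasNoForbiddenInduced_of_le_egirth hG))
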